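/- Let $N\ge 1$ and $\Delta>0$, $\sigma_u>0$, $\Sigma_0>0$. A *Kyle equilibrium* consists of real numbers $\hat\lambda_n,\hat\beta_n$ ($1\le n\le N$) and $\hat\Sigma_n,\hat\alpha_n$ ($0\le n\le N$) with $\hat\Sigma_0=\Sigma_0$, $\hat\alpha_N=0$ and, for $n=1,\dots,N$, $$\hat\lambda_n=\frac{\hat\beta_n\hat\Sigma_{n-1}}{\hat\beta_n^2\hat\Sigma_{n-1}\Delta+\sigma_u^2},\quad \hat\Sigma_n=\frac{\hat\Sigma_{n-1}\sigma_u^2}{\hat\beta_n^2\hat\Sigma_{n-1}\Delta+\sigma_u^2},\quad \hat\alpha_{n-1}=\frac1{4\hat\lambda_n(1-\hat\alpha_n\hat\lambda_n)},\quad \hat\beta_n=\frac{1-2\hat\alpha_n\hat\lambda_n}{2\Delta\hat\lambda_n(1-\hat\alpha_n\hat\lambda_n)},$$ together with the second-order condition $\hat\lambda_n>0$ and $\hat\alpha_n\hat\lambda_n<1$. For $\vec\beta\in\mathbb R^N$ define, forward in $n=1,\dots,N$ with given $\Sigma_0$, $$\lambda_n=\frac{\beta_n\Sigma_{n-1}}{\beta_n^2\Sigma_{n-1}\Delta+\sigma_u^2},\qquad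 \Sigma_n=\frac{\Sigma_{n-1}\sigma_u^2}{\beta_n^2\Sigma_{n-1}\Delta+\sigma_u^2},$$ and then, backward in $n=N,\dots,1$ with $\alpha_N=0$, $$T(\vec\beta)_n=\frac{1-2\alpha_n\lambda_n}{2\Delta\lambda_n(1-\alpha_n\lambda_n)},\qquad \alpha_{n-1}=\frac1{4\lambda_n(1-\alpha_n\lambda_n)}.$$ The domain $\mathrm{dom}(T)$ is the set of those $\vec\beta\in\mathbb R^N$ for which none of these denominators vanishes; off the domain, and at $\infty$, put $T:=\infty$. A Kyle equilibrium is *locally stable* (with respect to policy iterations for the insider) if there is $\varepsilon>0$ such that every $\vec\beta^{(0)}\in\mathrm{dom}(T)$ with $0<|\vec\beta^{(0)}-\vec{\hat\beta}|<\varepsilon$ (Euclidean norm) satisfies $\lim_{m\to\infty}\vec\beta^{(m)}=\vec{\hat\beta}$, where $\vec\beta^{(m+1)}=T(\vec\beta^{(m)})$. For $N\ge3$ and a Kyle equilibrium, let $\tilde T(x):=T(\hat\beta_1,\dots,\hat\beta_{N-3},x,\hat\beta_{N-1},\hat\beta_N)_{N-2}$ for $x\in\mathbb R$. **Theorem.**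 There is a real number $d=-2.07611\ldots$ (that is, $-2.07612<d\le-2.07611$) such that for all $N\ge3$, $\Delta>0$, $\sigma_u>0$, $\Sigma_0>0$ there is exactly one Kyle equilibrium, and it satisfies: 0. $\tilde T$ is finite near $\hat\beta_{N-2}$ and differentiable there, with $\tilde T'(\hat\beta_{N-2})=d$; in particular the derivative depends neither on $N$ nor on $(\Delta,\sigma_u,\Sigma_0)$. 1. For every $\beta^{(0)}_{N-2}\in\mathbb R$ with $\beta^{(0)}_{N-2}\ne\hat\beta_{N-2}$, the sequence $$\beta^{(m+1)}_{N-2}:=\hat\beta_{N-2}+\tilde T'(\hat\beta_{N-2})\bigl(\beta^{(m)}_{N-2}-\hat\beta_{N-2}\bigr),\qquad m=0,1,\dots,$$ diverges: $\lim_{m\to\infty}|\beta^{(m)}_{N-2}|=\infty$. 2. Kyle's equilibrium is not locally stable. -/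

import Mathlib

open Filter Topology

noncomputable section

namespace Kyle

/-! Kyle's discrete-time model with `N` trading times. The index `n : Fin N` stands for the
trading time `n + 1`; sequences that also have an entry at time `0` are indexed by `Fin (N + 1)`,
so that `S n.castSucc` is the value before trading time `n + 1` and `S n.succ` the value at it.
`Δ` is the time step, `σ` the noise-trader volatility and `V` the variance of the asset value. -/

/-- Candidate coefficients `(λ, Σ, α, β)` of a linear equilibrium. -/
structure Coeffs (N : ℕ) where
  lam : Fin N → ℝ
  Sig : Fin (N + 1) → ℝ
  alpha : Fin (N + 1) → ℝ
  beta : EuclideanSpace ℝ (Fin N)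

/-- Kyle's equilibrium equations, with the second-order condition `λ (1 - α λ) > 0` written as
`λ > 0` and `α λ < 1`. -/
structure Coeffs.IsEquilibrium {N : ℕ} (Δ σ V : ℝ) (c : Coeffs N) : Prop where
  Sig_zero : c.Sig 0 = V
  alpha_last : c.alpha (Fin.last N) = 0
  lam_eq : ∀ n : Fin N,
    c.lam n = c.beta n * c.Sig n.castSucc / (c.beta n ^ 2 * c.Sig n.castSucc * Δ + σ ^ 2)
  Sig_eq : ∀ n : Fin N,
    c.Sig n.succ = c.Sig n.castSucc * σ ^ 2 / (c.beta n ^ 2 * c.Sig n.castSucc * Δ + σ ^ 2)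
  alpha_eq : ∀ n : Fin N,
    c.alpha n.castSucc = 1 / (4 * c.lam n * (1 - c.alpha n.succ * c.lam n))
  beta_eq : ∀ n : Fin N,
    c.beta n = (1 - 2 * c.alpha n.succ * c.lam n) /
      (Δ * 2 * c.lam n * (1 - c.alpha n.succ * c.lam n))
  lam_pos : ∀ n : Fin N, 0 < c.lam n
  soc : ∀ n : Fin N, c.alpha n.succ * c.lam n < 1

/-- The posterior variances that the market makers compute, by forward recursion, from the
insider's trading intensities `β`. -/
def sigmaOf {N : ℕ} (Δ σ V : ℝ) (β : EuclideanSpace ℝ (Fin N)) : Fin (N + 1) → ℝ :=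
  Fin.induction (motive := fun _ => ℝ) V
    (fun n s => s * σ ^ 2 / (β n ^ 2 * s * Δ + σ ^ 2))

/-- The market makers' price impact coefficients in response to `β`. -/
def lambdaOf {N : ℕ} (Δ σ V : ℝ) (β : EuclideanSpace ℝ (Fin N)) (n : Fin N) : ℝ :=
  β n * sigmaOf Δ σ V β n.castSucc / (β n ^ 2 * sigmaOf Δ σ V β n.castSucc * Δ + σ ^ 2)

/-- The coefficients of the insider's value function in response to the price impact `lam`, by
backward recursion from the terminal value `0`. -/
def alphaOf {N : ℕ} (lam : Fin N → ℝ) : Fin (N + 1) → ℝ :=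
  fun k => Fin.reverseInduction (motive := fun _ => ℝ) 0
    (fun n a => 1 / (4 * lam n * (1 - a * lam n))) k

/-- The insider's optimal trading intensities in response to the price impact `lam`. -/
def bestResponse {N : ℕ} (Δ : ℝ) (lam : Fin N → ℝ) : EuclideanSpace ℝ (Fin N) :=
  WithLp.toLp 2 fun n =>
    (1 - 2 * alphaOf lam n.succ * lam n) / (Δ * 2 * lam n * (1 - alphaOf lam n.succ * lam n))

/-- The domain of the policy iteration operator: no denominator in the recursion vanishes. -/
def dom {N : ℕ} (Δ σ V : ℝ) : Set (EuclideanSpace ℝ (Fin N)) :=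
  {β | ∀ n : Fin N, lambdaOf Δ σ V β n ≠ 0 ∧
    1 - alphaOf (lambdaOf Δ σ V β) n.succ * lambdaOf Δ σ V β n ≠ 0}

open Classical in
/-- The policy iteration operator `T`. The point `∞` of the one-point compactification plays the
role of the value `(∞, …, ∞)` that is assigned off the domain. -/
def T {N : ℕ} (Δ σ V : ℝ) (x : OnePoint (EuclideanSpace ℝ (Fin N))) :
    OnePoint (EuclideanSpace ℝ (Fin N)) :=
  x.elim OnePoint.infty fun β =>
    if β ∈ dom Δ σ V then OnePoint.some (bestResponse Δ (lambdaOf Δ σ V β)) else OnePoint.infty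

/-- Local stability of `b` under policy iterations of the insider. -/
def IsLocallyStable {N : ℕ} (Δ σ V : ℝ) (b : EuclideanSpace ℝ (Fin N)) : Prop :=
  ∃ ε > 0, ∀ β₀ ∈ dom Δ σ V, 0 < ‖β₀ - b‖ → ‖β₀ - b‖ < ε →
    Tendsto (fun m : ℕ => (T Δ σ V)^[m] (OnePoint.some β₀)) atTop (𝓝 (OnePoint.some b))

/-- The `i`-th coordinate of `T` as a function of the `i`-th variable alone, the other variables
being held at `b`; its value is `∞` off the domain of `T`. -/
def scalarT {N : ℕ} (Δ σ V : ℝ) (b : EuclideanSpace ℝ (Fin N)) (i : Fin N) (x : ℝ) :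
    OnePoint ℝ :=
  (T Δ σ V (OnePoint.some (WithLp.toLp 2 (Function.update (⇑b) i x)))).map fun β => β i

/-- The function `f`, with values in `ℝ ∪ {∞}`, is finite near `x` and has derivative `d` at `x`. -/
def HasFiniteDerivAt (f : ℝ → OnePoint ℝ) (d x : ℝ) : Prop :=
  ∃ g : ℝ → ℝ, (∀ᶠ y in 𝓝 x, f y = OnePoint.some (g y)) ∧ HasDerivAt g d x

end Kyle

end

/-! Put `q = α λ`. In equilibrium, `β² Σ Δ = (1 - 2q) σ²`, with `Σ` taken before the trade. Hence `q
< 1/2`, and `q` determines all variance ratios and price impacts. Eliminating `Σ` and `λ` between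
consecutive times leaves the scale-free cubic `8 (1 - 2q) p² (1 - p) = 1 - 2p`, which gives the
earlier value `p` from the later value `q` and has exactly one root in `(0, 1/2)`. Starting from `q
= 0` at the last time, `q` depends only on the number of remaining times (`qseq`). This yields
existence and uniqueness of the equilibrium.

Differentiating the recursions at the equilibrium gives a Jacobian whose diagonal entries are also
universal (`diagDeriv`). The entry with two times remaining is `d`.

The scalar expansion `|d| > 1` does not by itself make the full map unstable; the trace does. The
three last diagonal entries sum to less than `-3` and all earlier ones are at most `-1`, so the
trace is below `-N` and some eigenvalue lies outside the closed unit disc.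

Such an eigenvalue still allows individual orbits to converge, so it must be shown that not all
nearby ones do. A cone argument (`exists_orbit_escape`), which needs no hyperbolicity, shows that
the orbits of a nonempty open set cannot all stay close to the fixed point. If every nearby orbit
converged, Baire's theorem would give an open set `O` and a time `m` after which all orbits from `O`
stay close. The iteration is a local diffeomorphism at a dense set of points, so the image of `O`
after `m` steps contains an open set (`iterate_image_interior_nonempty`), a contradiction. -/

namespace Kyle

/-! ### The universal recursion for `α λ` and its numerical bounds -/

/-- One backward step of the recursion satisfied by `q = α λ` in equilibrium. -/
structure Step (q p : ℝ) : Prop where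
  pos : 0 < p
  lt_half : p < 1 / 2
  eq : 8 * (1 - 2 * q) * (p ^ 2 * (1 - p)) = 1 - 2 * p

theorem exists_step {q : ℝ} (hq : q < 1 / 2) : ∃ p, Step q p := by
  have hc : ContinuousOn (fun p : ℝ => 8 * (1 - 2 * q) * (p ^ 2 * (1 - p)) - (1 - 2 * p))
      (Set.Icc 0 (1 / 2)) := by fun_prop
  have h := intermediate_value_Ioo (by norm_num : (0 : ℝ) ≤ 1 / 2) hc
  have h0 : (0 : ℝ) ∈ Set.Ioo (8 * (1 - 2 * q) * ((0 : ℝ) ^ 2 * (1 - 0)) - (1 - 2 * 0))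
      (8 * (1 - 2 * q) * ((1 / 2 : ℝ) ^ 2 * (1 - 1 / 2)) - (1 - 2 * (1 / 2))) := by
    constructor
    · norm_num
    · norm_num
      linarith
  obtain ⟨p, hp, hpe⟩ := h h0
  exact ⟨p, hp.1, hp.2, by simpa [sub_eq_zero] using hpe⟩

theorem sq_mul_one_sub_mono {x y : ℝ} (hx : 0 ≤ x) (hxy : x ≤ y) (hy : y ≤ 1 / 2) :
    x ^ 2 * (1 - x) ≤ y ^ 2 * (1 - y) := by
  have h : 0 ≤ (y - x) * (x * (1 - x - y) + y * (1 - y)) := by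
    apply mul_nonneg (by linarith)
    have h1 : 0 ≤ x * (1 - x - y) := mul_nonneg hx (by linarith)
    have h2 : 0 ≤ y * (1 - y) := mul_nonneg (by linarith) (by linarith)
    linarith
  nlinarith [h]

/-- On `[0, 1/2]` the left side of the cubic increases and `1 - 2p` decreases, so the sign of their
difference at a trial point `c` tells on which side of `c` the root lies. All numerical bounds rest
on this and on `Step.gt_of`. -/
theorem Step.lt_of {q p c : ℝ} (h : Step q p) (hq : q < 1 / 2) (hc' : c ≤ 1 / 2)
    (hlt : 8 * (1 - 2 * q) * (c ^ 2 * (1 - c)) < 1 - 2 * c) : c < p := by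
  by_contra hcon
  have h1 := sq_mul_one_sub_mono h.pos.le (not_lt.1 hcon) hc'
  have h2 := mul_le_mul_of_nonneg_left h1 (by linarith : 0 ≤ 8 * (1 - 2 * q))
  linarith [h.eq]

theorem Step.gt_of {q p c : ℝ} (h : Step q p) (hq : q < 1 / 2) (hc : 0 ≤ c)
    (hlt : 1 - 2 * c < 8 * (1 - 2 * q) * (c ^ 2 * (1 - c))) : p < c := by
  by_contra hcon
  have h1 := sq_mul_one_sub_mono hc (not_lt.1 hcon) h.lt_half.le
  have h2 := mul_le_mul_of_nonneg_left h1 (by linarith : 0 ≤ 8 * (1 - 2 * q))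
  linarith [h.eq]

theorem Step.unique {q p p' : ℝ} (h : Step q p) (h' : Step q p') (hq : q < 1 / 2) : p = p' := by
  rcases lt_trichotomy p p' with hlt | heq | hlt
  · have h1 := sq_mul_one_sub_mono h.pos.le hlt.le h'.lt_half.le
    have h2 := mul_le_mul_of_nonneg_left h1 (by linarith : 0 ≤ 8 * (1 - 2 * q))
    linarith [h.eq, h'.eq]
  · exact heq
  · have h1 := sq_mul_one_sub_mono h'.pos.le hlt.le h.lt_half.le
    have h2 := mul_le_mul_of_nonneg_left h1 (by linarith : 0 ≤ 8 * (1 - 2 * q))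
    linarith [h.eq, h'.eq]

/-- The values below `1 / 2` generated by the backward recursion from `0`. -/
noncomputable def qsub : ℕ → {q : ℝ // 0 ≤ q ∧ q < 1 / 2}
  | 0 => ⟨0, le_rfl, by norm_num⟩
  | k + 1 => ⟨(exists_step (qsub k).2.2).choose,
      (exists_step (qsub k).2.2).choose_spec.pos.le,
      (exists_step (qsub k).2.2).choose_spec.lt_half⟩

/-- The equilibrium value of `α λ`, as a function of the number of remaining trading times. -/
noncomputable def qseq (k : ℕ) : ℝ := (qsub k).1

theorem qseq_zero : qseq 0 = 0 := rfl

theorem qseq_nonneg (k : ℕ) : 0 ≤ qseq k := (qsub k).2.1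

theorem qseq_lt (k : ℕ) : qseq k < 1 / 2 := (qsub k).2.2

theorem qseq_step (k : ℕ) : Step (qseq k) (qseq (k + 1)) :=
  (exists_step (qsub k).2.2).choose_spec

/-- The logarithmic derivative of the insider's value coefficient with respect to the current
posterior variance, the insider's future intensities being fixed. -/
noncomputable def valueElast : ℕ → ℝ
  | 0 => 0
  | k + 1 => 1 / (2 * (1 - qseq k)) * (-1 + qseq k / (1 - qseq k) * (1 + valueElast k))

/-- The derivative of a coordinate of the policy iteration with respect to that coordinate. -/
noncomputable def diagDeriv (k : ℕ) : ℝ :=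
  -(qseq k / (1 - qseq k)) - qseq k ^ 2 / ((1 - 2 * qseq k) * (1 - qseq k) ^ 2) +
    qseq k * valueElast k / (1 - qseq k) ^ 2

theorem valueElast_mem (k : ℕ) : -1 ≤ valueElast k ∧ valueElast k ≤ 0 := by
  induction k with
  | zero => simp [valueElast]
  | succ k ih =>
    have h0 := qseq_nonneg k
    have h1 := qseq_lt k
    have hp : 0 < 1 - qseq k := by linarith
    have hr0 : 0 ≤ qseq k / (1 - qseq k) := div_nonneg h0 hp.le
    have hr1 : qseq k / (1 - qseq k) ≤ 1 := by rw [div_le_one hp]; linarith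
    have hg0 : 0 ≤ 1 / (2 * (1 - qseq k)) := by positivity
    have hg1 : 1 / (2 * (1 - qseq k)) ≤ 1 := by rw [div_le_one (by linarith)]; linarith
    have hm0 : 0 ≤ qseq k / (1 - qseq k) * (1 + valueElast k) :=
      mul_nonneg hr0 (by linarith [ih.1])
    have hm1 : qseq k / (1 - qseq k) * (1 + valueElast k) ≤ 1 :=
      mul_le_one₀ hr1 (by linarith [ih.1]) (by linarith [ih.2])
    simp only [valueElast]
    constructor <;> nlinarith

theorem qseq_one_gt : 0.277479066 < qseq 1 :=
  (qseq_step 0).lt_of (qseq_lt 0) (by norm_num) (by rw [qseq_zero]; norm_num)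

theorem qseq_one_lt : qseq 1 < 0.277479067 :=
  (qseq_step 0).gt_of (qseq_lt 0) (by norm_num) (by rw [qseq_zero]; norm_num)

theorem qseq_two_gt : 0.355186743 < qseq 2 :=
  (qseq_step 1).lt_of (qseq_lt 1) (by norm_num) (by
    norm_num
    nlinarith [qseq_one_gt])

theorem qseq_two_lt : qseq 2 < 0.355186746 :=
  (qseq_step 1).gt_of (qseq_lt 1) (by norm_num) (by
    norm_num
    nlinarith [qseq_one_lt])

theorem qseq_ge (k : ℕ) : 0.32 < qseq (k + 2) := by
  -- Since `0.32 > 0.27`, the bound reproduces itself along the recursion; `qseq 1` starts it.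
  have aux : ∀ k, 0.27 < qseq k → 0.32 < qseq (k + 1) := fun k h =>
    (qseq_step k).lt_of (qseq_lt k) (by norm_num) (by norm_num; linarith)
  induction k with
  | zero => exact aux 1 (by linarith [qseq_one_gt])
  | succ k ih => exact aux _ (by linarith)

/-- The elasticity term is nonpositive, and for `q > 0.32` the other two are at most `-0.47` and
`-0.6`. -/
theorem diagDeriv_le (k : ℕ) : diagDeriv (k + 2) ≤ -1 := by
  have h0 := qseq_ge k
  have h1 := qseq_lt (k + 2)
  have hD := valueElast_mem (k + 2)
  unfold diagDeriv
  generalize qseq (k + 2) = q at *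
  generalize valueElast (k + 2) = D at *
  have hp : 0 < 1 - q := by linarith
  have hp2 : 0 < 1 - 2 * q := by linarith
  have h3 : q * D / (1 - q) ^ 2 ≤ 0 :=
    div_nonpos_of_nonpos_of_nonneg (mul_nonpos_of_nonneg_of_nonpos (by linarith) hD.2)
      (by positivity)
  have h4 : 0.47 ≤ q / (1 - q) := by rw [le_div_iff₀ hp]; linarith
  have h5 : (1 - 2 * q) * (1 - q) ^ 2 ≤ 0.17 := by
    calc (1 - 2 * q) * (1 - q) ^ 2 ≤ 0.36 * 0.68 ^ 2 := by
          gcongr <;> linarith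
      _ ≤ 0.17 := by norm_num
  have h6 : 0.6 ≤ q ^ 2 / ((1 - 2 * q) * (1 - q) ^ 2) := by
    rw [le_div_iff₀ (by positivity)]
    nlinarith
  linarith

theorem diagDeriv_zero : diagDeriv 0 = 0 := by simp [diagDeriv, qseq_zero]

theorem valueElast_one : valueElast 1 = -(1 / 2) := by
  simp [valueElast, qseq_zero]

theorem diagDeriv_one_le : diagDeriv 1 ≤ -0.98 := by
  have h0 := qseq_one_gt
  have h1 := qseq_one_lt
  unfold diagDeriv
  rw [valueElast_one]
  generalize qseq 1 = q at *
  have hp : 0 < 1 - q := by linarith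
  have hp2 : 0 < 1 - 2 * q := by linarith
  have h4 : 0.384 ≤ q / (1 - q) := by rw [le_div_iff₀ hp]; linarith
  have h6 : 0.331 ≤ q ^ 2 / ((1 - 2 * q) * (1 - q) ^ 2) := by
    rw [le_div_iff₀ (by positivity)]
    calc 0.331 * ((1 - 2 * q) * (1 - q) ^ 2)
        ≤ 0.331 * ((1 - 2 * 0.277479066) * (1 - 0.277479066) ^ 2) := by gcongr
      _ ≤ 0.277479066 ^ 2 := by norm_num
      _ ≤ q ^ 2 := by gcongr
  have h7 : q * -(1 / 2) / (1 - q) ^ 2 ≤ -0.265 := by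
    rw [div_le_iff₀ (by positivity)]
    nlinarith
  linarith

theorem valueElast_two_mem : -0.559138495 < valueElast 2 ∧ valueElast 2 < -0.559138485 := by
  have h0 := qseq_one_gt
  have h1 := qseq_one_lt
  have he : valueElast 2 = 1 / (2 * (1 - qseq 1)) * (-1 + qseq 1 / (1 - qseq 1) * (1 + valueElast 1)) :=
    rfl
  rw [he, valueElast_one]
  generalize qseq 1 = q at *
  have hp : 0 < 1 - q := by linarith
  have e : 1 / (2 * (1 - q)) * (-1 + q / (1 - q) * (1 + -(1 / 2))) =
      (-2 + 3 * q) / (4 * (1 - q) ^ 2) := by field_simp; ring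
  rw [e, lt_div_iff₀ (by positivity), div_lt_iff₀ (by positivity)]
  constructor <;> nlinarith

theorem diagDeriv_two_mem : -2.07612 < diagDeriv 2 ∧ diagDeriv 2 ≤ -2.07611 := by
  have h0 := qseq_two_gt
  have h1 := qseq_two_lt
  obtain ⟨hD0, hD1⟩ := valueElast_two_mem
  unfold diagDeriv
  generalize qseq 2 = q at *
  generalize valueElast 2 = D at *
  have hp : 0 < 1 - q := by linarith
  have hp2 : 0 < 1 - 2 * q := by linarith
  have hA0 : 0.55083659 < q / (1 - q) := by rw [lt_div_iff₀ hp]; linarith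
  have hA1 : q / (1 - q) < 0.55083662 := by rw [div_lt_iff₀ hp]; linarith
  have hB0 : 1.0476283 < q ^ 2 / ((1 - 2 * q) * (1 - q) ^ 2) := by
    rw [lt_div_iff₀ (by positivity)]
    calc 1.0476283 * ((1 - 2 * q) * (1 - q) ^ 2)
        ≤ 1.0476283 * ((1 - 2 * 0.355186743) * (1 - 0.355186743) ^ 2) := by gcongr
      _ < 0.355186743 ^ 2 := by norm_num
      _ ≤ q ^ 2 := by gcongr
  have hB1 : q ^ 2 / ((1 - 2 * q) * (1 - q) ^ 2) < 1.0476286 := by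
    rw [div_lt_iff₀ (by positivity)]
    calc q ^ 2 ≤ 0.355186746 ^ 2 := by gcongr
      _ < 1.0476286 * ((1 - 2 * 0.355186746) * (1 - 0.355186746) ^ 2) := by norm_num
      _ ≤ 1.0476286 * ((1 - 2 * q) * (1 - q) ^ 2) := by
        gcongr
  have hC0 : 0.85425755 < q / (1 - q) ^ 2 := by
    rw [lt_div_iff₀ (by positivity)]; nlinarith
  have hC1 : q / (1 - q) ^ 2 < 0.8542576 := by
    rw [div_lt_iff₀ (by positivity)]; nlinarith
  have e : q * D / (1 - q) ^ 2 = q / (1 - q) ^ 2 * D := by ring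
  rw [e]
  constructor <;> nlinarith

end Kyle

/-! ### Existence and uniqueness of the equilibrium -/

namespace Kyle

theorem alphaOf_last {N : ℕ} (lam : Fin N → ℝ) : alphaOf lam (Fin.last N) = 0 := by
  simp [alphaOf]

theorem alphaOf_castSucc {N : ℕ} (lam : Fin N → ℝ) (n : Fin N) :
    alphaOf lam n.castSucc = 1 / (4 * lam n * (1 - alphaOf lam n.succ * lam n)) := by
  simp [alphaOf]

theorem sigmaOf_zero {N : ℕ} (Δ σ V : ℝ) (β : EuclideanSpace ℝ (Fin N)) :
    sigmaOf Δ σ V β 0 = V := rfl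

theorem sigmaOf_succ {N : ℕ} (Δ σ V : ℝ) (β : EuclideanSpace ℝ (Fin N)) (n : Fin N) :
    sigmaOf Δ σ V β n.succ = sigmaOf Δ σ V β n.castSucc * σ ^ 2 /
      (β n ^ 2 * sigmaOf Δ σ V β n.castSucc * Δ + σ ^ 2) := by
  simp [sigmaOf]

variable {N : ℕ} {Δ σ V : ℝ} {c : Coeffs N}

/-- The product `α λ` at a trading time. -/
def Coeffs.q (c : Coeffs N) (n : Fin N) : ℝ := c.alpha n.succ * c.lam n

/-- The relations that determine an equilibrium from the values `q` of `α λ`. -/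
structure Coeffs.IsReduced (Δ σ V : ℝ) (q : Fin N → ℝ) (c : Coeffs N) : Prop where
  Sig_zero : c.Sig 0 = V
  Sig_pos : ∀ k, 0 < c.Sig k
  lam_pos : ∀ n, 0 < c.lam n
  q_lt : ∀ n, q n < 1 / 2
  Sig_eq : ∀ n : Fin N, c.Sig n.castSucc = 2 * (1 - q n) * c.Sig n.succ
  lam_sq : ∀ n : Fin N, c.lam n ^ 2 * (2 * (1 - q n) * Δ * σ ^ 2) = (1 - 2 * q n) * c.Sig n.succ
  beta_eq : ∀ n : Fin N, c.beta n * c.Sig n.succ = c.lam n * σ ^ 2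
  alpha_last : c.alpha (Fin.last N) = 0
  alpha_eq : ∀ n : Fin N, c.alpha n.castSucc = 1 / (4 * c.lam n * (1 - q n))

theorem Coeffs.IsEquilibrium.Sig_pos (h : c.IsEquilibrium Δ σ V) (hΔ : 0 < Δ) (hσ : 0 < σ)
    (hV : 0 < V) (k : Fin (N + 1)) : 0 < c.Sig k := by
  induction k using Fin.induction with
  | zero => rw [h.Sig_zero]; exact hV
  | succ n ih => rw [h.Sig_eq]; positivity

/-- Inserting the formula for `l` into that for `b` gives `b² s Δ = (1 - 2q) σ²`, so the common
denominator collapses to `2 (1 - q) σ²`. Positivity of the left side sharpens the second-order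
condition `q < 1` to `q < 1/2`. -/
theorem reduced_relations {s s' b l q : ℝ} (hΔ : 0 < Δ) (hσ : 0 < σ) (hs : 0 < s) (hl : 0 < l)
    (hq : q < 1) (h1 : l = b * s / (b ^ 2 * s * Δ + σ ^ 2))
    (h2 : s' = s * σ ^ 2 / (b ^ 2 * s * Δ + σ ^ 2))
    (h3 : b = (1 - 2 * q) / (Δ * 2 * l * (1 - q))) :
    b ^ 2 * s * Δ = (1 - 2 * q) * σ ^ 2 ∧ q < 1 / 2 ∧ s = 2 * (1 - q) * s' ∧
      b * s' = l * σ ^ 2 ∧ l ^ 2 * (2 * (1 - q) * Δ * σ ^ 2) = (1 - 2 * q) * s' := by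
  have hD : 0 < b ^ 2 * s * Δ + σ ^ 2 := by positivity
  have hq1 : 0 < 1 - q := by linarith
  have hσ2 : 0 < σ ^ 2 := by positivity
  rw [eq_div_iff hD.ne'] at h1 h2
  rw [eq_div_iff (by positivity)] at h3
  have hb : 0 < b := by
    have : 0 < b * s := by rw [← h1]; positivity
    exact (pos_iff_pos_of_mul_pos this).2 hs
  have e1 : b ^ 2 * s * Δ = (1 - 2 * q) * σ ^ 2 := by
    linear_combination (-2 * Δ * b * (1 - q)) * h1 + (b ^ 2 * s * Δ + σ ^ 2) * h3
  have hq2 : q < 1 / 2 := by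
    have : 0 < (1 - 2 * q) * σ ^ 2 := by rw [← e1]; positivity
    linarith [(pos_iff_pos_of_mul_pos this).2 hσ2]
  have hD' : b ^ 2 * s * Δ + σ ^ 2 = 2 * (1 - q) * σ ^ 2 := by linear_combination e1
  have e2 : s = 2 * (1 - q) * s' := by
    rw [hD'] at h2
    apply mul_right_cancel₀ hσ2.ne'
    linear_combination -h2
  have e3 : b * s' = l * σ ^ 2 := by
    rw [hD'] at h1
    apply mul_right_cancel₀ hq1.ne'
    linear_combination (-1 / 2) * h1 - b / 2 * e2
  refine ⟨e1, hq2, e2, e3, ?_⟩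
  apply mul_right_cancel₀ hσ2.ne'
  linear_combination (-2 * (1 - q) * Δ * (l * σ ^ 2 + b * s')) * e3 - b ^ 2 * s' * Δ * e2 + s' * e1

theorem Coeffs.IsEquilibrium.isReduced (h : c.IsEquilibrium Δ σ V) (hΔ : 0 < Δ) (hσ : 0 < σ)
    (hV : 0 < V) : c.IsReduced Δ σ V c.q := by
  have key := fun n : Fin N => reduced_relations hΔ hσ (h.Sig_pos hΔ hσ hV n.castSucc)
    (h.lam_pos n) (h.soc n) (h.lam_eq n) (h.Sig_eq n) (q := c.q n) (by
      rw [h.beta_eq n]; unfold Coeffs.q; ring_nf)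
  exact ⟨h.Sig_zero, h.Sig_pos hΔ hσ hV, h.lam_pos, fun n => (key n).2.1,
    fun n => (key n).2.2.1, fun n => (key n).2.2.2.2, fun n => (key n).2.2.2.1, h.alpha_last,
    fun n => by rw [h.alpha_eq n]; unfold Coeffs.q; ring_nf⟩

theorem Coeffs.IsEquilibrium.beta_sq (h : c.IsEquilibrium Δ σ V) (hΔ : 0 < Δ) (hσ : 0 < σ)
    (hV : 0 < V) (n : Fin N) :
    c.beta n ^ 2 * c.Sig n.castSucc * Δ = (1 - 2 * c.q n) * σ ^ 2 :=
  (reduced_relations hΔ hσ (h.Sig_pos hΔ hσ hV n.castSucc)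
    (h.lam_pos n) (h.soc n) (h.lam_eq n) (h.Sig_eq n) (q := c.q n) (by
      rw [h.beta_eq n]; unfold Coeffs.q; ring_nf)).1

theorem Coeffs.IsEquilibrium.beta_pos (h : c.IsEquilibrium Δ σ V) (hΔ : 0 < Δ) (hσ : 0 < σ)
    (hV : 0 < V) (n : Fin N) : 0 < c.beta n := by
  have := (h.isReduced hΔ hσ hV).beta_eq n
  have h2 : 0 < c.beta n * c.Sig n.succ := by
    rw [this]; have := h.lam_pos n; positivity
  exact (pos_iff_pos_of_mul_pos h2).2 (h.Sig_pos hΔ hσ hV _)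

/-- The recursion for `α` makes `c.q n` a multiple of the ratio of successive price impacts.
Squaring that ratio and using `lam_sq` at both times cancels `Σ`, `Δ` and `σ`. -/
theorem Coeffs.IsEquilibrium.step (h : c.IsEquilibrium Δ σ V) (hΔ : 0 < Δ) (hσ : 0 < σ)
    (hV : 0 < V) {n m : Fin N} (hnm : n.succ = m.castSucc) : Step (c.q m) (c.q n) := by
  have r := h.isReduced hΔ hσ hV
  have hqm : 0 < 1 - c.q m := by linarith [r.q_lt m]
  have hlm := r.lam_pos m
  have hln := r.lam_pos n
  have hs := r.Sig_pos m.succ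
  have ha : c.alpha n.succ = 1 / (4 * c.lam m * (1 - c.q m)) := by rw [hnm, r.alpha_eq]
  have hq : c.q n = c.lam n / (4 * c.lam m * (1 - c.q m)) := by
    rw [Coeffs.q, ha]; ring
  refine ⟨by rw [hq]; positivity, r.q_lt n, ?_⟩
  rw [eq_div_iff (by positivity)] at hq
  have e1 := r.lam_sq n
  have e2 := r.lam_sq m
  have e3 := r.Sig_eq m
  rw [hnm, e3] at e1
  have hne : 2 * (1 - c.q m) * c.Sig m.succ ≠ 0 := by positivity
  apply mul_right_cancel₀ hne
  generalize c.q n = p at *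
  generalize c.q m = q at *
  generalize c.lam n = l at *
  generalize c.lam m = k at *
  rw [← hq] at e1
  linear_combination e1 - 16 * p ^ 2 * (1 - q) * (1 - p) * e2

theorem Coeffs.IsEquilibrium.q_eq (h : c.IsEquilibrium Δ σ V) (hΔ : 0 < Δ) (hσ : 0 < σ)
    (hV : 0 < V) (n : Fin N) : c.q n = qseq (N - 1 - n) := by
  have key : ∀ k : ℕ, ∀ n : Fin N, N - 1 - (n : ℕ) = k → c.q n = qseq k := by
    intro k
    induction k with
    | zero =>
      intro n hn
      have : n.succ = Fin.last N := by ext; simp; omega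
      rw [Coeffs.q, this, h.alpha_last, zero_mul, qseq_zero]
    | succ k ih =>
      intro n hn
      let m : Fin N := ⟨n + 1, by omega⟩
      have hnm : n.succ = m.castSucc := by ext; simp [m]
      have hm := ih m (by simp only [m]; omega)
      have hst := h.step hΔ hσ hV hnm
      rw [hm] at hst
      exact hst.unique (qseq_step k) (qseq_lt k)
  exact key _ n rfl

theorem Coeffs.IsReduced.ext {q : Fin N → ℝ} {c c' : Coeffs N} (h : c.IsReduced Δ σ V q)
    (h' : c'.IsReduced Δ σ V q) (hΔ : 0 < Δ) (hσ : 0 < σ) : c = c' := by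
  have hq : ∀ n, 0 < 1 - q n := fun n => by linarith [h.q_lt n]
  have hS : c.Sig = c'.Sig := by
    funext k
    induction k using Fin.induction with
    | zero => rw [h.Sig_zero, h'.Sig_zero]
    | succ n ih =>
      rw [h.Sig_eq, h'.Sig_eq] at ih
      have := hq n
      exact mul_left_cancel₀ (by positivity) ih
  have hl : c.lam = c'.lam := by
    funext n
    have e := h.lam_sq n
    rw [hS, ← h'.lam_sq n] at e
    have := hq n
    exact (pow_left_inj₀ (h.lam_pos n).le (h'.lam_pos n).le two_ne_zero).1
      (mul_right_cancel₀ (by positivity) e)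
  have hb : c.beta = c'.beta := by
    ext n
    have e := h.beta_eq n
    rw [hl, ← h'.beta_eq n, hS] at e
    exact mul_right_cancel₀ (h'.Sig_pos _).ne' e
  have ha : c.alpha = c'.alpha := by
    funext k
    induction k using Fin.lastCases with
    | last => rw [h.alpha_last, h'.alpha_last]
    | cast n => rw [h.alpha_eq, h'.alpha_eq, hl]
  cases c
  cases c'
  simp_all

/-- The equilibrium, in terms of the universal values of `α λ`. -/
noncomputable def equilibrium (N : ℕ) (Δ σ V : ℝ) : Coeffs N :=
  let S : Fin (N + 1) → ℝ := fun k =>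
    V / ∏ j ∈ Finset.range k, (2 * (1 - qseq (N - 1 - j)))
  let L : Fin N → ℝ := fun n =>
    √((1 - 2 * qseq (N - 1 - n)) * S n.succ / (2 * (1 - qseq (N - 1 - n)) * Δ * σ ^ 2))
  { Sig := S
    lam := L
    alpha := alphaOf L
    beta := WithLp.toLp 2 fun n => L n * σ ^ 2 / S n.succ }

theorem equilibrium_isEquilibrium (hΔ : 0 < Δ) (hσ : 0 < σ) (hV : 0 < V) :
    (equilibrium N Δ σ V).IsEquilibrium Δ σ V := by
  set c := equilibrium N Δ σ V with hc
  let q : Fin N → ℝ := fun n => qseq (N - 1 - n)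
  have hq1 : ∀ n, 0 < 1 - q n := fun n => by linarith [qseq_lt (N - 1 - n)]
  have hq2 : ∀ n, 0 < 1 - 2 * q n := fun n => by linarith [qseq_lt (N - 1 - n)]
  have hSpos : ∀ k, 0 < c.Sig k := fun k =>
    div_pos hV (Finset.prod_pos fun j _ => by linarith [qseq_lt (N - 1 - j)])
  have hS : ∀ n : Fin N, c.Sig n.castSucc = 2 * (1 - q n) * c.Sig n.succ := by
    intro n
    have hp : ∏ j ∈ Finset.range n, (2 * (1 - qseq (N - 1 - j))) ≠ 0 :=
      Finset.prod_ne_zero_iff.2 fun j _ => by linarith [qseq_lt (N - 1 - j)]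
    have := hq1 n
    simp only [hc, equilibrium, Fin.val_castSucc, Fin.val_succ, Finset.prod_range_succ]
    change _ = 2 * (1 - q n) * (V / (_ * (2 * (1 - q n))))
    field_simp
  have hlsq : ∀ n : Fin N,
      c.lam n ^ 2 * (2 * (1 - q n) * Δ * σ ^ 2) = (1 - 2 * q n) * c.Sig n.succ := by
    intro n
    have h1 := hq1 n
    have h2 := hq2 n
    have h3 := hSpos n.succ
    have e : c.lam n = √((1 - 2 * q n) * c.Sig n.succ / (2 * (1 - q n) * Δ * σ ^ 2)) := rfl
    rw [e, Real.sq_sqrt (by positivity), div_mul_cancel₀ _ (by positivity)]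
  have hlpos : ∀ n : Fin N, 0 < c.lam n := by
    intro n
    have h1 := hq1 n
    have h2 := hq2 n
    have h3 := hSpos n.succ
    exact Real.sqrt_pos.2 (by positivity)
  have hb : ∀ n : Fin N, c.beta n * c.Sig n.succ = c.lam n * σ ^ 2 := fun n =>
    div_mul_cancel₀ _ (hSpos n.succ).ne'
  have hal : c.alpha = alphaOf c.lam := rfl
  -- The `α` recursion holds by construction; the content is that it reproduces the prescribed `q`,
  -- by induction on the number of remaining times.
  have haq : ∀ n : Fin N, c.alpha n.succ * c.lam n = q n := by
    intro n
    induction hk : N - 1 - (n : ℕ) generalizing n with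
    | zero =>
      have : n.succ = Fin.last N := by ext; simp; omega
      rw [hal, this, alphaOf_last, zero_mul]
      simp only [q, hk, qseq_zero]
    | succ k ih =>
      let m : Fin N := ⟨n + 1, by omega⟩
      have hnm : n.succ = m.castSucc := by ext; simp [m]
      have hkm : N - 1 - (m : ℕ) = k := by simp only [m]; omega
      have hm := ih m hkm
      have hlm := hlpos m
      have hqm := hq1 m
      rw [hnm, hal, alphaOf_castSucc, ← hal, hm, one_div_mul_eq_div, div_eq_iff (by positivity)]
      have hst : Step (q m) (q n) := by
        simp only [q, hk, hkm]; exact qseq_step k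
      have e1 := hlsq n
      rw [hnm, hS m] at e1
      have e2 := hlsq m
      have e3 := hst.eq
      have hqn := hq1 n
      have hqp := hst.pos
      -- Both sides are positive, so squares may be compared; they agree by the cubic.
      rw [← pow_left_inj₀ (hlpos n).le (by positivity) two_ne_zero]
      have hne : 2 * (1 - q n) * Δ * σ ^ 2 ≠ 0 := by positivity
      apply mul_right_cancel₀ hne
      linear_combination e1 - 2 * (1 - q m) * c.Sig m.succ * e3 -
        16 * q n ^ 2 * (1 - q m) * (1 - q n) * e2
  have hbsq : ∀ n : Fin N, c.beta n ^ 2 * c.Sig n.castSucc * Δ = (1 - 2 * q n) * σ ^ 2 := by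
    intro n
    apply mul_right_cancel₀ (hSpos n.succ).ne'
    rw [hS]
    linear_combination (2 * Δ * (1 - q n) * (c.beta n * c.Sig n.succ + c.lam n * σ ^ 2)) * hb n +
      σ ^ 2 * hlsq n
  have hD : ∀ n : Fin N, c.beta n ^ 2 * c.Sig n.castSucc * Δ + σ ^ 2 = 2 * (1 - q n) * σ ^ 2 :=
    fun n => by rw [hbsq]; ring
  refine ⟨?_, alphaOf_last _, ?_, ?_, alphaOf_castSucc _, ?_, hlpos, ?_⟩
  · simp [hc, equilibrium]
  · intro n
    have := hq1 n
    rw [hD, eq_div_iff (by positivity), hS]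
    linear_combination -2 * (1 - q n) * hb n
  · intro n
    have := hq1 n
    rw [hD, eq_div_iff (by positivity), hS]
    ring
  · intro n
    have h1 := hq1 n
    have h2 := hlpos n
    have h3 := hSpos n.succ
    have e : c.alpha n.succ * c.lam n = q n := haq n
    rw [show 1 - 2 * c.alpha n.succ * c.lam n = 1 - 2 * q n by rw [← e]; ring, e,
      eq_div_iff (by positivity)]
    apply mul_right_cancel₀ h3.ne'
    linear_combination Δ * 2 * c.lam n * (1 - q n) * hb n + hlsq n
  · intro n
    rw [haq]
    linarith [hq1 n]

theorem existsUnique_isEquilibrium (hΔ : 0 < Δ) (hσ : 0 < σ) (hV : 0 < V) :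
    ∃! c : Coeffs N, c.IsEquilibrium Δ σ V := by
  refine ⟨equilibrium N Δ σ V, equilibrium_isEquilibrium hΔ hσ hV, fun c hc => ?_⟩
  have h := equilibrium_isEquilibrium (N := N) hΔ hσ hV
  have r := hc.isReduced hΔ hσ hV
  have r' := h.isReduced hΔ hσ hV
  rw [funext (hc.q_eq hΔ hσ hV)] at r
  rw [funext (h.q_eq hΔ hσ hV)] at r'
  exact r.ext r' hΔ hσ

theorem Coeffs.IsEquilibrium.sigmaOf_eq (h : c.IsEquilibrium Δ σ V) :
    sigmaOf Δ σ V c.beta = c.Sig := by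
  funext k
  induction k using Fin.induction with
  | zero => rw [sigmaOf_zero, h.Sig_zero]
  | succ n ih => rw [sigmaOf_succ, ih, h.Sig_eq]

theorem Coeffs.IsEquilibrium.lambdaOf_eq (h : c.IsEquilibrium Δ σ V) :
    lambdaOf Δ σ V c.beta = c.lam := by
  funext n
  rw [lambdaOf, h.sigmaOf_eq, h.lam_eq]

theorem Coeffs.IsEquilibrium.alphaOf_eq (h : c.IsEquilibrium Δ σ V) :
    alphaOf c.lam = c.alpha := by
  funext k
  induction k using Fin.reverseInduction with
  | last => rw [alphaOf_last, h.alpha_last]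
  | cast n ih => rw [alphaOf_castSucc, ih, h.alpha_eq]

theorem Coeffs.IsEquilibrium.mem_dom (h : c.IsEquilibrium Δ σ V) : c.beta ∈ dom Δ σ V := by
  intro n
  rw [h.lambdaOf_eq, h.alphaOf_eq]
  exact ⟨(h.lam_pos n).ne', by linarith [h.soc n]⟩

theorem Coeffs.IsEquilibrium.bestResponse_eq (h : c.IsEquilibrium Δ σ V) :
    bestResponse Δ (lambdaOf Δ σ V c.beta) = c.beta := by
  ext n
  rw [h.lambdaOf_eq, h.beta_eq n]
  simp only [bestResponse, h.alphaOf_eq]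

end Kyle

/-! ### Smoothness and linearization of the policy iteration -/

namespace Kyle

variable {N : ℕ} {Δ σ V : ℝ}

/-- The policy iteration operator on its domain, as a map of Euclidean space. -/
noncomputable def iter (Δ σ V : ℝ) (β : EuclideanSpace ℝ (Fin N)) : EuclideanSpace ℝ (Fin N) :=
  bestResponse Δ (lambdaOf Δ σ V β)

theorem iter_apply (β : EuclideanSpace ℝ (Fin N)) (n : Fin N) :
    iter Δ σ V β n =
      (1 - 2 * alphaOf (lambdaOf Δ σ V β) n.succ * lambdaOf Δ σ V β n) /
        (Δ * 2 * lambdaOf Δ σ V β n *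
          (1 - alphaOf (lambdaOf Δ σ V β) n.succ * lambdaOf Δ σ V β n)) := rfl

theorem sigmaOf_pos (hΔ : 0 < Δ) (hσ : 0 < σ) (hV : 0 < V) (β : EuclideanSpace ℝ (Fin N))
    (k : Fin (N + 1)) : 0 < sigmaOf Δ σ V β k := by
  induction k using Fin.induction with
  | zero => exact hV
  | succ n ih => rw [sigmaOf_succ]; positivity

theorem denom_pos (hΔ : 0 < Δ) (hσ : 0 < σ) (hV : 0 < V) (β : EuclideanSpace ℝ (Fin N))
    (n : Fin N) : 0 < β n ^ 2 * sigmaOf Δ σ V β n.castSucc * Δ + σ ^ 2 := by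
  have := sigmaOf_pos hΔ hσ hV β n.castSucc
  positivity

theorem contDiff_coord (n : Fin N) : ContDiff ℝ 1 fun β : EuclideanSpace ℝ (Fin N) => β n :=
  (EuclideanSpace.proj n : EuclideanSpace ℝ (Fin N) →L[ℝ] ℝ).contDiff

theorem contDiff_sigmaOf (hΔ : 0 < Δ) (hσ : 0 < σ) (hV : 0 < V) (k : Fin (N + 1)) :
    ContDiff ℝ 1 fun β : EuclideanSpace ℝ (Fin N) => sigmaOf Δ σ V β k := by
  induction k using Fin.induction with
  | zero => exact contDiff_const
  | succ n ih =>
    simp only [sigmaOf_succ]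
    exact (ih.mul contDiff_const).div
      (((((contDiff_coord n).pow 2).mul ih).mul contDiff_const).add contDiff_const)
      fun β => (denom_pos hΔ hσ hV β n).ne'

theorem contDiff_lambdaOf (hΔ : 0 < Δ) (hσ : 0 < σ) (hV : 0 < V) (n : Fin N) :
    ContDiff ℝ 1 fun β : EuclideanSpace ℝ (Fin N) => lambdaOf Δ σ V β n := by
  have ih := contDiff_sigmaOf (N := N) hΔ hσ hV n.castSucc
  exact ((contDiff_coord n).mul ih).div
    (((((contDiff_coord n).pow 2).mul ih).mul contDiff_const).add contDiff_const)
    fun β => (denom_pos hΔ hσ hV β n).ne'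

theorem contDiffAt_alphaOf (hΔ : 0 < Δ) (hσ : 0 < σ) (hV : 0 < V)
    {β : EuclideanSpace ℝ (Fin N)} (hβ : β ∈ dom Δ σ V) (k : Fin (N + 1)) :
    ContDiffAt ℝ 1 (fun β : EuclideanSpace ℝ (Fin N) => alphaOf (lambdaOf Δ σ V β) k) β := by
  induction k using Fin.reverseInduction with
  | last => simpa only [alphaOf_last] using contDiffAt_const
  | cast n ih =>
    have hl := (contDiff_lambdaOf (N := N) hΔ hσ hV n).contDiffAt (x := β)
    simp only [alphaOf_castSucc]
    exact contDiffAt_const.div ((contDiffAt_const.mul hl).mul (contDiffAt_const.sub (ih.mul hl)))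
      (mul_ne_zero (mul_ne_zero four_ne_zero (hβ n).1) (hβ n).2)

theorem contDiffAt_iter (hΔ : 0 < Δ) (hσ : 0 < σ) (hV : 0 < V)
    {β : EuclideanSpace ℝ (Fin N)} (hβ : β ∈ dom Δ σ V) :
    ContDiffAt ℝ 1 (iter Δ σ V) β := by
  rw [contDiffAt_euclidean]
  intro n
  have hl := (contDiff_lambdaOf (N := N) hΔ hσ hV n).contDiffAt (x := β)
  have ha := contDiffAt_alphaOf hΔ hσ hV hβ n.succ
  simp only [iter_apply]
  exact (contDiffAt_const.sub ((contDiffAt_const.mul ha).mul hl)).div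
    ((contDiffAt_const.mul hl).mul (contDiffAt_const.sub (ha.mul hl)))
    (mul_ne_zero (mul_ne_zero (mul_ne_zero hΔ.ne' two_ne_zero) (hβ n).1) (hβ n).2)

theorem isOpen_dom (hΔ : 0 < Δ) (hσ : 0 < σ) (hV : 0 < V) :
    IsOpen (dom Δ σ V : Set (EuclideanSpace ℝ (Fin N))) := by
  rw [isOpen_iff_mem_nhds]
  intro β hβ
  have : ∀ n : Fin N, ∀ᶠ y in 𝓝 β, lambdaOf Δ σ V y n ≠ 0 ∧
      1 - alphaOf (lambdaOf Δ σ V y) n.succ * lambdaOf Δ σ V y n ≠ 0 := by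
    intro n
    have hl := (contDiff_lambdaOf (N := N) hΔ hσ hV n).contDiffAt (x := β)
    have ha := contDiffAt_alphaOf hΔ hσ hV hβ n.succ
    exact (hl.continuousAt.eventually_ne (hβ n).1).and
      ((contDiffAt_const.sub (ha.mul hl)).continuousAt.eventually_ne (hβ n).2)
  exact eventually_all.2 this

section Calculus

variable {s x l a : ℝ → ℝ} {s' x' l' a' t : ℝ}

theorem hasDerivAt_sigma_step (hs : HasDerivAt s s' t) (hx : HasDerivAt x x' t)
    (hD : x t ^ 2 * s t * Δ + σ ^ 2 ≠ 0) :
    HasDerivAt (fun t => s t * σ ^ 2 / (x t ^ 2 * s t * Δ + σ ^ 2))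
      ((s' * σ ^ 4 - 2 * σ ^ 2 * Δ * s t ^ 2 * x t * x') /
        (x t ^ 2 * s t * Δ + σ ^ 2) ^ 2) t := by
  convert! (hs.mul_const (σ ^ 2)).div ((((hx.pow 2).mul hs).mul_const Δ).add_const (σ ^ 2)) hD
    using 1
  simp
  ring

theorem hasDerivAt_lambda_step (hs : HasDerivAt s s' t) (hx : HasDerivAt x x' t)
    (hD : x t ^ 2 * s t * Δ + σ ^ 2 ≠ 0) :
    HasDerivAt (fun t => x t * s t / (x t ^ 2 * s t * Δ + σ ^ 2))
      ((x' * s t * (σ ^ 2 - x t ^ 2 * s t * Δ) + x t * s' * σ ^ 2) /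
        (x t ^ 2 * s t * Δ + σ ^ 2) ^ 2) t := by
  convert! (hx.mul hs).div ((((hx.pow 2).mul hs).mul_const Δ).add_const (σ ^ 2)) hD using 1
  simp
  ring

theorem hasDerivAt_alpha_step (hl : HasDerivAt l l' t) (ha : HasDerivAt a a' t)
    (h1 : l t ≠ 0) (h2 : 1 - a t * l t ≠ 0) :
    HasDerivAt (fun t => 1 / (4 * l t * (1 - a t * l t)))
      (1 / (4 * l t * (1 - a t * l t)) *
        (-(l' / l t) + (a' * l t + a t * l') / (1 - a t * l t))) t := by
  convert! (hasDerivAt_const t (1 : ℝ)).div ((hl.const_mul 4).mul ((ha.mul hl).const_sub 1))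
    (mul_ne_zero (mul_ne_zero four_ne_zero h1) h2) using 1
  simp
  field_simp
  ring

theorem hasDerivAt_response (hΔ : 0 < Δ) (hl : HasDerivAt l l' t) (ha : HasDerivAt a a' t)
    (h1 : l t ≠ 0) (h2 : 1 - a t * l t ≠ 0) :
    HasDerivAt (fun t => (1 - 2 * a t * l t) / (Δ * 2 * l t * (1 - a t * l t)))
      (-((1 - 2 * a t * l t) / (Δ * 2 * l t * (1 - a t * l t)) * (l' / l t)) -
        (a' * l t + a t * l') / (Δ * 2 * l t * (1 - a t * l t) ^ 2)) t := by
  convert! (((ha.const_mul 2).mul hl).const_sub 1).div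
    ((hl.const_mul (Δ * 2)).mul ((ha.mul hl).const_sub 1))
    (mul_ne_zero (mul_ne_zero (mul_ne_zero hΔ.ne' two_ne_zero) h1) h2) using 1
  simp
  have := hΔ.ne'
  field_simp
  ring

end Calculus

/-- The directional derivatives `S'`, `L'`, `A'` of the posterior variances, price impacts and
value function coefficients at `β` in the direction `v`, and the one `w` of the response. -/
structure IsLinearization (Δ σ V : ℝ) (β v w : EuclideanSpace ℝ (Fin N))
    (S' : Fin (N + 1) → ℝ) (L' : Fin N → ℝ) (A' : Fin (N + 1) → ℝ) : Prop where
  S_zero : S' 0 = 0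
  S_succ : ∀ n : Fin N, S' n.succ =
    (S' n.castSucc * σ ^ 4 - 2 * σ ^ 2 * Δ * sigmaOf Δ σ V β n.castSucc ^ 2 * β n * v n) /
      (β n ^ 2 * sigmaOf Δ σ V β n.castSucc * Δ + σ ^ 2) ^ 2
  L_eq : ∀ n : Fin N, L' n =
    (v n * sigmaOf Δ σ V β n.castSucc * (σ ^ 2 - β n ^ 2 * sigmaOf Δ σ V β n.castSucc * Δ) +
      β n * S' n.castSucc * σ ^ 2) /
      (β n ^ 2 * sigmaOf Δ σ V β n.castSucc * Δ + σ ^ 2) ^ 2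
  A_last : A' (Fin.last N) = 0
  A_castSucc : ∀ n : Fin N, A' n.castSucc = alphaOf (lambdaOf Δ σ V β) n.castSucc *
    (-(L' n / lambdaOf Δ σ V β n) +
      (A' n.succ * lambdaOf Δ σ V β n + alphaOf (lambdaOf Δ σ V β) n.succ * L' n) /
        (1 - alphaOf (lambdaOf Δ σ V β) n.succ * lambdaOf Δ σ V β n))
  response : ∀ n : Fin N, w n = -(iter Δ σ V β n * (L' n / lambdaOf Δ σ V β n)) -
    (A' n.succ * lambdaOf Δ σ V β n + alphaOf (lambdaOf Δ σ V β) n.succ * L' n) /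
      (Δ * 2 * lambdaOf Δ σ V β n *
        (1 - alphaOf (lambdaOf Δ σ V β) n.succ * lambdaOf Δ σ V β n) ^ 2)

/-- Each recursion is differentiated along the line `β + t • v`; uniqueness of derivatives
identifies the results with the Fréchet derivatives. -/
theorem exists_isLinearization (hΔ : 0 < Δ) (hσ : 0 < σ) (hV : 0 < V)
    {β : EuclideanSpace ℝ (Fin N)} (hβ : β ∈ dom Δ σ V) (v : EuclideanSpace ℝ (Fin N)) :
    ∃ S' L' A', IsLinearization Δ σ V β v (fderiv ℝ (iter Δ σ V) β v) S' L' A' := by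
  have hγ : HasDerivAt (fun t : ℝ => β + t • v) v 0 := by
    simpa using ((hasDerivAt_id (0 : ℝ)).smul_const v).const_add β
  have h0 : β + (0 : ℝ) • v = β := by simp
  have comp : ∀ {F : Type} [NormedAddCommGroup F] [NormedSpace ℝ F]
      {f : EuclideanSpace ℝ (Fin N) → F}, ContDiffAt ℝ 1 f β →
      HasDerivAt (fun t : ℝ => f (β + t • v)) (fderiv ℝ f β v) 0 := by
    intro F _ _ f hf
    have := (hf.differentiableAt one_ne_zero).hasFDerivAt
    rw [← h0] at this
    have := this.comp_hasDerivAt (0 : ℝ) hγ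
    simpa only [h0, Function.comp_def] using this
  have hS := fun k => comp (contDiff_sigmaOf (N := N) hΔ hσ hV k).contDiffAt
  have hL := fun n => comp (contDiff_lambdaOf (N := N) hΔ hσ hV n).contDiffAt
  have hA := fun k => comp (contDiffAt_alphaOf hΔ hσ hV hβ k)
  have hc : ∀ n, HasDerivAt (fun t : ℝ => (β + t • v) n) (v n) 0 := fun n => by
    simpa using ((hasDerivAt_id (0 : ℝ)).mul_const (v n)).const_add (β n)
  have hw : ∀ n, HasDerivAt (fun t : ℝ => iter Δ σ V (β + t • v) n)
      (fderiv ℝ (iter Δ σ V) β v n) 0 := fun n =>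
    (EuclideanSpace.proj n : EuclideanSpace ℝ (Fin N) →L[ℝ] ℝ).hasFDerivAt.comp_hasDerivAt 0
      (comp (contDiffAt_iter hΔ hσ hV hβ))
  have hD := fun n => (denom_pos hΔ hσ hV (β + (0 : ℝ) • v) n).ne'
  have hβ' : β + (0 : ℝ) • v ∈ dom Δ σ V := by rwa [h0]
  refine ⟨fun k => fderiv ℝ (fun β => sigmaOf Δ σ V β k) β v,
    fun n => fderiv ℝ (fun β => lambdaOf Δ σ V β n) β v,
    fun k => fderiv ℝ (fun β => alphaOf (lambdaOf Δ σ V β) k) β v,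
    ?_, fun n => ?_, fun n => ?_, ?_, fun n => ?_, fun n => ?_⟩
  · exact (hS 0).unique (hasDerivAt_const _ V)
  · have e := hasDerivAt_sigma_step (hS n.castSucc) (hc n) (hD n)
    simp only [← sigmaOf_succ] at e
    simpa only [h0] using (hS n.succ).unique e
  · have e := hasDerivAt_lambda_step (hS n.castSucc) (hc n) (hD n)
    simpa only [h0] using (hL n).unique e
  · have e := hA (Fin.last N)
    simp only [alphaOf_last] at e
    simpa only [alphaOf_last] using e.unique (hasDerivAt_const _ 0)
  · have e := hasDerivAt_alpha_step (hL n) (hA n.succ) (hβ' n).1 (hβ' n).2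
    simp only [← alphaOf_castSucc] at e
    simpa only [h0] using (hA n.castSucc).unique e
  · have e := hasDerivAt_response hΔ (hL n) (hA n.succ) (hβ' n).1 (hβ' n).2
    simp only [← iter_apply] at e
    simpa only [h0] using (hw n).unique e

end Kyle

/-! ### Diagonal of the Jacobian, and open sets in images of the iteration -/

namespace Kyle

variable {N : ℕ} {Δ σ V : ℝ} {c : Coeffs N}

theorem IsLinearization.apply_eq_diagDeriv (h : c.IsEquilibrium Δ σ V) (hΔ : 0 < Δ) (hσ : 0 < σ)
    (hV : 0 < V) {i : Fin N} {w : EuclideanSpace ℝ (Fin N)} {S' : Fin (N + 1) → ℝ}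
    {L' : Fin N → ℝ} {A' : Fin (N + 1) → ℝ}
    (H : IsLinearization Δ σ V c.beta (EuclideanSpace.single i 1) w S' L' A') :
    w i = diagDeriv (N - 1 - i) := by
  obtain ⟨H0, HS, HL, HAl, HA, HW⟩ := H
  have hit : iter Δ σ V c.beta = c.beta := h.bestResponse_eq
  rw [hit] at HW
  rw [h.lambdaOf_eq, h.alphaOf_eq] at HA HW
  rw [h.sigmaOf_eq] at HS HL
  have r := h.isReduced hΔ hσ hV
  have hbsq := h.beta_sq hΔ hσ hV
  have hb := h.beta_pos hΔ hσ hV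
  have hq1 : ∀ n, 0 < 1 - c.q n := fun n => by linarith [r.q_lt n]
  have hD : ∀ n : Fin N, c.beta n ^ 2 * c.Sig n.castSucc * Δ + σ ^ 2 = 2 * (1 - c.q n) * σ ^ 2 :=
    fun n => by rw [hbsq]; ring
  simp only [hD] at HS HL
  have hq : ∀ n, c.alpha n.succ * c.lam n = c.q n := fun n => rfl
  simp only [hq] at HA HW
  have hlam : ∀ n, c.lam n = c.beta n * c.Sig n.castSucc / (2 * (1 - c.q n) * σ ^ 2) :=
    fun n => by rw [h.lam_eq n, hD]
  have hSig : ∀ n : Fin N, c.Sig n.succ = c.Sig n.castSucc / (2 * (1 - c.q n)) := fun n => by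
    have := hq1 n
    rw [eq_div_iff (by positivity), r.Sig_eq]; ring
  -- Posterior variances up to the perturbed trade do not see the perturbation.
  have hS0 : ∀ k : Fin (N + 1), k ≤ i.castSucc → S' k = 0 := by
    intro k
    induction k using Fin.induction with
    | zero => exact fun _ => H0
    | succ n ih =>
      intro hk
      have hn : n < i := Fin.succ_le_castSucc_iff.1 hk
      rw [HS, ih (Fin.castSucc_le_castSucc_iff.2 hn.le), PiLp.single_apply, if_neg hn.ne]
      simp
  -- After trade `i` the perturbation acts only through the inherited variance, so the relative
  -- change of `α` is the elasticity times the relative change of `Σ`.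
  have hA : ∀ k : Fin (N + 1), i.castSucc < k →
      A' k = c.alpha k * valueElast (N - k) * (S' k / c.Sig k) := by
    intro k
    induction k using Fin.reverseInduction with
    | last => simp [HAl, valueElast]
    | cast n ih =>
      intro hk
      have hn : i < n := Fin.castSucc_lt_castSucc_iff.1 hk
      have ih := ih (hk.trans n.castSucc_lt_succ)
      have hk1 : N - (n.castSucc : ℕ) = (N - 1 - n) + 1 := by simp; omega
      have hk2 : N - (n.succ : ℕ) = N - 1 - n := by simp; omega
      have h1 := hq1 n
      have h2 := hb n
      have h3 := r.Sig_pos n.castSucc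
      have h4 := hb n
      have hL : L' n = c.lam n * (S' n.castSucc / c.Sig n.castSucc) / (2 * (1 - c.q n)) := by
        rw [HL, hlam, PiLp.single_apply, if_neg hn.ne']
        field_simp
        ring
      have hS : S' n.succ / c.Sig n.succ =
          S' n.castSucc / c.Sig n.castSucc / (2 * (1 - c.q n)) := by
        rw [HS, hSig, PiLp.single_apply, if_neg hn.ne']
        field_simp
        ring
      rw [hk2, hS] at ih
      rw [HA, ih, hL, hk1, valueElast, ← h.q_eq hΔ hσ hV n]
      have h5 := h.lam_pos n
      rw [show c.alpha n.succ = c.q n / c.lam n by rw [← hq n, mul_div_cancel_right₀ _ h5.ne']]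
      generalize valueElast (N - 1 - n) = D
      generalize S' n.castSucc / c.Sig n.castSucc = E
      generalize c.alpha n.castSucc = A
      field_simp
      ring
  have h1 := hq1 i
  have h2 := hb i
  have h3 := r.Sig_pos i.castSucc
  have h5 := h.lam_pos i
  have h6 : 0 < 1 - 2 * c.q i := by linarith [r.q_lt i]
  have hL : L' i = c.lam i * (c.q i / (1 - c.q i)) / c.beta i := by
    rw [HL, hlam, PiLp.single_apply, if_pos rfl, hS0 _ le_rfl, hbsq]
    field_simp
    ring
  have hS : S' i.succ / c.Sig i.succ = -((1 - 2 * c.q i) / (1 - c.q i)) / c.beta i := by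
    rw [HS, hSig, PiLp.single_apply, if_pos rfl, hS0 _ le_rfl]
    have e := hbsq i
    field_simp
    linear_combination -2 * c.Sig i.castSucc * e
  have hA' := hA i.succ i.castSucc_lt_succ
  have hk2 : N - (i.succ : ℕ) = N - 1 - i := by simp; omega
  rw [hS, hk2] at hA'
  have hT : Δ * 2 * c.lam i * (1 - c.q i) = (1 - 2 * c.q i) / c.beta i := by
    have e := h.beta_eq i
    rw [hq, show 1 - 2 * c.alpha i.succ * c.lam i = 1 - 2 * c.q i by rw [← hq i]; ring] at e
    rw [e]
    have := r.q_lt i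
    field_simp
  rw [HW, hL, hA', show Δ * 2 * c.lam i * (1 - c.q i) ^ 2 =
    (Δ * 2 * c.lam i * (1 - c.q i)) * (1 - c.q i) by ring, hT,
    show c.alpha i.succ = c.q i / c.lam i by rw [← hq i, mul_div_cancel_right₀ _ h5.ne'],
    diagDeriv, ← h.q_eq hΔ hσ hV i]
  generalize valueElast (N - 1 - i) = D
  clear hT hL hS hA' hA
  generalize c.q i = q at *
  have h1' := h1.ne'
  have h6' := h6.ne'
  have h7 : 1 - q * 2 ≠ 0 := by rwa [mul_comm]
  field_simp
  ring

/-- The linearized system is triangular. Backward from the last time, a vanishing response forces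
`L' = 0` and `A' = 0`; forward from `S' 0 = 0`, this forces `v = 0`, since `hu` keeps the
coefficient of `v n` in `L' n` nonzero. -/
theorem IsLinearization.eq_zero (hΔ : 0 < Δ) (hσ : 0 < σ) (hV : 0 < V)
    {β v : EuclideanSpace ℝ (Fin N)} (hβ : β ∈ dom Δ σ V)
    (hu : ∀ n, β n ^ 2 * sigmaOf Δ σ V β n.castSucc * Δ ≠ σ ^ 2) {S' : Fin (N + 1) → ℝ}
    {L' : Fin N → ℝ} {A' : Fin (N + 1) → ℝ} (H : IsLinearization Δ σ V β v 0 S' L' A') :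
    v = 0 := by
  obtain ⟨H0, HS, HL, HAl, HA, HW⟩ := H
  have hLA : ∀ n, A' n.succ = 0 → L' n = 0 := by
    intro n ha
    have e := HW n
    obtain ⟨h1, h2⟩ := hβ n
    rw [iter_apply, ha] at e
    generalize lambdaOf Δ σ V β n = l at *
    generalize alphaOf (lambdaOf Δ σ V β) n.succ = a at *
    have hΔ' := hΔ.ne'
    -- The factor equals `((1 - 2 a l)² + 1) / 2` and so never vanishes.
    have hz : L' n * (1 - 2 * (a * l) + 2 * (a * l) ^ 2) = 0 := by
      simp only [PiLp.zero_apply] at e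
      field_simp at e
      linear_combination e
    rcases mul_eq_zero.1 hz with hz | hz
    · exact hz
    · nlinarith [sq_nonneg (1 - 2 * (a * l))]
  have hA : ∀ k, A' k = 0 := by
    intro k
    induction k using Fin.reverseInduction with
    | last => exact HAl
    | cast n ih => rw [HA, hLA n ih, ih]; simp
  have hL : ∀ n, L' n = 0 := fun n => hLA n (hA _)
  have hv : ∀ n, S' n.castSucc = 0 → v n = 0 := by
    intro n hs
    have e := HL n
    have hD := (denom_pos hΔ hσ hV β n).ne'
    rw [hL, hs, eq_comm, div_eq_zero_iff, or_iff_left (pow_ne_zero 2 hD)] at e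
    have hs := (sigmaOf_pos hΔ hσ hV β n.castSucc).ne'
    have := sub_ne_zero.2 (hu n).symm
    simpa [hs, this] using e
  have hS : ∀ k, S' k = 0 := by
    intro k
    induction k using Fin.induction with
    | zero => exact H0
    | succ n ih => rw [HS, ih, hv n ih]; simp
  ext n
  exact hv n (hS _)

theorem map_nhds_iter (hΔ : 0 < Δ) (hσ : 0 < σ) (hV : 0 < V)
    {β : EuclideanSpace ℝ (Fin N)} (hβ : β ∈ dom Δ σ V)
    (hu : ∀ n, β n ^ 2 * sigmaOf Δ σ V β n.castSucc * Δ ≠ σ ^ 2) :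
    map (iter Δ σ V) (𝓝 β) = 𝓝 (iter Δ σ V β) := by
  refine HasStrictFDerivAt.map_nhds_eq_of_surj
    ((contDiffAt_iter hΔ hσ hV hβ).hasStrictFDerivAt one_ne_zero) ?_
  refine LinearMap.range_eq_top.2 (LinearMap.injective_iff_surjective.1
    ((injective_iff_map_eq_zero _).2 fun v hv => ?_))
  obtain ⟨S', L', A', H⟩ := exists_isLinearization hΔ hσ hV hβ v
  have hv' : fderiv ℝ (iter Δ σ V) β v = 0 := hv
  rw [hv'] at H
  exact H.eq_zero hΔ hσ hV hβ hu

theorem sigmaOf_congr {β β' : EuclideanSpace ℝ (Fin N)} {k : Fin (N + 1)}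
    (h : ∀ n : Fin N, n.castSucc < k → β n = β' n) : sigmaOf Δ σ V β k = sigmaOf Δ σ V β' k := by
  induction k using Fin.induction with
  | zero => rfl
  | succ n ih =>
    rw [sigmaOf_succ, sigmaOf_succ, ih fun m hm => h m (hm.trans n.castSucc_lt_succ),
      h n n.castSucc_lt_succ]

/-- Moving coordinate `n` alone leaves the variance before trade `n` unchanged, so the excluded
equation is quadratic in that coordinate and has at most two roots. -/
theorem dense_regular (hΔ : 0 < Δ) (hσ : 0 < σ) (hV : 0 < V) :
    Dense {β : EuclideanSpace ℝ (Fin N) |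
      ∀ n, β n ^ 2 * sigmaOf Δ σ V β n.castSucc * Δ ≠ σ ^ 2} := by
  have hopen : ∀ n : Fin N, IsOpen {β : EuclideanSpace ℝ (Fin N) |
      β n ^ 2 * sigmaOf Δ σ V β n.castSucc * Δ ≠ σ ^ 2} := fun n =>
    isOpen_ne_fun (((((contDiff_coord n).pow 2).mul (contDiff_sigmaOf hΔ hσ hV _)).mul
      contDiff_const).continuous) continuous_const
  rw [Set.ofPred_forall]
  refine dense_iInter_of_isOpen hopen fun n β => ?_
  rw [mem_closure_iff_nhds]
  intro U hU
  let γ : ℝ → EuclideanSpace ℝ (Fin N) := fun t => β + t • EuclideanSpace.single n 1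
  have hγ : ContinuousAt γ 0 := by fun_prop
  have h0 : γ 0 = β := by simp [γ]
  have hev : ∀ᶠ t in 𝓝[≠] (0 : ℝ), γ t ∈ U :=
    (hγ.eventually (by rwa [h0])).filter_mono nhdsWithin_le_nhds
  have hS : ∀ t, sigmaOf Δ σ V (γ t) n.castSucc = sigmaOf Δ σ V β n.castSucc := fun t =>
    sigmaOf_congr fun m hm => by
      have : m ≠ n := (Fin.castSucc_lt_castSucc_iff.1 hm).ne
      simp [γ, this]
  have hn : ∀ t, γ t n = β n + t := fun t => by simp [γ]
  set s := sigmaOf Δ σ V β n.castSucc with hs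
  have hspos : 0 < s := sigmaOf_pos hΔ hσ hV β _
  have hfin : {t : ℝ | (β n + t) ^ 2 * s * Δ = σ ^ 2}.Finite := by
    refine (Set.toFinite {√(σ ^ 2 / (s * Δ)) - β n, -√(σ ^ 2 / (s * Δ)) - β n}).subset ?_
    intro t ht
    have e : (β n + t) ^ 2 = √(σ ^ 2 / (s * Δ)) ^ 2 := by
      rw [Real.sq_sqrt (by positivity), eq_div_iff (by positivity), ← mul_assoc]
      exact ht
    rcases sq_eq_sq_iff_eq_or_eq_neg.1 e with e | e
    · left; linarith
    · right; simp only [Set.mem_singleton_iff]; linarith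
  have hne : ∀ᶠ t in 𝓝[≠] (0 : ℝ), t ∉ {t : ℝ | (β n + t) ^ 2 * s * Δ = σ ^ 2} := by
    filter_upwards [nhdsWithin_le_nhds ((hfin.sdiff (t := {0})).isClosed.isOpen_compl.mem_nhds
      (x := 0) (by simp)), self_mem_nhdsWithin] with t h1 h2 h3
    exact h1 ⟨h3, h2⟩
  obtain ⟨t, ht, ht'⟩ := (hev.and hne).exists
  refine ⟨γ t, ht, ?_⟩
  simp only [Set.mem_ofPred_eq, hS, hn]
  exact ht'

theorem iter_image_interior_nonempty (hΔ : 0 < Δ) (hσ : 0 < σ) (hV : 0 < V)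
    {O : Set (EuclideanSpace ℝ (Fin N))} (hO : IsOpen O) (hne : O.Nonempty)
    (hd : O ⊆ dom Δ σ V) : (interior (iter Δ σ V '' O)).Nonempty := by
  obtain ⟨β, hβ, hu⟩ := (dense_regular hΔ hσ hV).inter_open_nonempty O hO hne
  refine ⟨iter Δ σ V β, mem_interior_iff_mem_nhds.2 ?_⟩
  rw [← map_nhds_iter hΔ hσ hV (hd hβ) hu]
  exact image_mem_map (hO.mem_nhds hβ)

end Kyle

/-! ### Spectral splitting of a complex endomorphism -/

open scoped ENNReal NNReal

namespace Kyle

section Spectral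

variable {W : Type*} [NormedAddCommGroup W] [NormedSpace ℂ W] [FiniteDimensional ℂ W]

/-- By Gelfand's formula `‖f ^ k‖ ≤ r ^ k` eventually, for some `r < θ`, and `(r / θ) ^ k` drops
below any `C`. The lower bound `eventually_le_norm_pow` is this applied to the inverse. -/
theorem eventually_norm_pow_le (f : Module.End ℂ W) {θ : ℝ} (hθ : 0 < θ)
    (hf : ∀ μ, f.HasEigenvalue μ → ‖μ‖ < θ) {C : ℝ} (hC : 0 < C) :
    ∀ᶠ k : ℕ in atTop, ∀ z, ‖(f ^ k) z‖ ≤ C * θ ^ k * ‖z‖ := by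
  rcases subsingleton_or_nontrivial W with hW | hW
  · exact Eventually.of_forall fun k z => by simp [Subsingleton.elim z 0]
  have : CompleteSpace W := FiniteDimensional.complete ℂ W
  let Φ := Module.End.toContinuousLinearMap (𝕜 := ℂ) W
  let a : W →L[ℂ] W := Φ f
  have hspec : ∀ z ∈ spectrum ℂ a, ‖z‖₊ < θ.toNNReal := by
    intro z hz
    rw [AlgEquiv.spectrum_eq, ← Module.End.hasEigenvalue_iff_mem_spectrum] at hz
    rw [← NNReal.coe_lt_coe, coe_nnnorm, Real.coe_toNNReal _ hθ.le]
    exact hf z hz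
  obtain ⟨r, hr1, hr2⟩ := ENNReal.lt_iff_exists_nnreal_btwn.1
    (spectrum.spectralRadius_lt_of_forall_lt a hspec)
  have hrθ : (r : ℝ) < θ := by
    have := NNReal.coe_lt_coe.2 (ENNReal.coe_lt_coe.1 hr2)
    rwa [Real.coe_toNNReal _ hθ.le] at this
  have h1 := (spectrum.pow_nnnorm_pow_one_div_tendsto_nhds_spectralRadius a).eventually_lt_const hr1
  have h2 : Tendsto (fun k : ℕ => ((r : ℝ) / θ) ^ k) atTop (𝓝 0) :=
    tendsto_pow_atTop_nhds_zero_of_lt_one (by positivity) (by rwa [div_lt_one hθ])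
  filter_upwards [h1, h2.eventually_lt_const hC, eventually_gt_atTop 0] with k hk1 hk2 hk3 z
  have hk : ‖a ^ k‖ ≤ (r : ℝ) ^ k := by
    have e : ((‖a ^ k‖₊ : ℝ≥0∞) ^ (1 / k : ℝ)) ^ (k : ℝ) ≤ (r : ℝ≥0∞) ^ (k : ℝ) :=
      ENNReal.rpow_le_rpow hk1.le (by positivity)
    rw [← ENNReal.rpow_mul, one_div_mul_cancel (by positivity), ENNReal.rpow_one,
      ENNReal.rpow_natCast] at e
    exact_mod_cast e
  have hka : (f ^ k) z = (a ^ k) z := by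
    have : a ^ k = Φ (f ^ k) := (map_pow Φ f k).symm
    rw [this]; rfl
  rw [hka]
  refine ((a ^ k).le_opNorm z).trans ?_
  gcongr
  rw [div_pow, div_lt_iff₀ (by positivity)] at hk2
  exact hk.trans hk2.le

theorem eventually_le_norm_pow (f : Module.End ℂ W) {θ : ℝ} (hθ : 0 < θ)
    (hf : ∀ μ, f.HasEigenvalue μ → θ < ‖μ‖) {C : ℝ} (hC : 0 < C) :
    ∀ᶠ k : ℕ in atTop, ∀ z, C * θ ^ k * ‖z‖ ≤ ‖(f ^ k) z‖ := by
  have h0 : ¬ f.HasEigenvalue 0 := fun h => by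
    have := hf 0 h
    rw [norm_zero] at this
    linarith
  rw [Module.End.hasEigenvalue_iff_mem_spectrum, spectrum.zero_mem_iff, not_not] at h0
  obtain ⟨u, rfl⟩ := h0
  have hinv : ∀ μ, Module.End.HasEigenvalue (↑u⁻¹ : Module.End ℂ W) μ → ‖μ‖ < θ⁻¹ := by
    intro μ hμ
    obtain ⟨z, hz⟩ := hμ.exists_hasEigenvector
    have e := hz.apply_eq_smul
    have hz0 : z ≠ 0 := hz.2
    have e2 : z = μ • (u : Module.End ℂ W) z := by
      have e3 : (u : Module.End ℂ W) ((↑u⁻¹ : Module.End ℂ W) z) = z := by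
        rw [← Module.End.mul_apply, Units.mul_inv, Module.End.one_apply]
      rw [e, map_smul] at e3
      exact e3.symm
    have hμ0 : μ ≠ 0 := by
      rintro rfl
      rw [zero_smul] at e2
      exact hz0 e2
    have e4 : (u : Module.End ℂ W) z = μ⁻¹ • z := by
      conv_rhs => rw [e2]
      rw [inv_smul_smul₀ hμ0]
    have h := hf μ⁻¹ (Module.End.hasEigenvalue_of_hasEigenvector
      ⟨Module.End.mem_eigenspace_iff.2 e4, hz0⟩)
    rw [norm_inv] at h
    rw [lt_inv_comm₀ (norm_pos_iff.2 hμ0) hθ]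
    exact h
  filter_upwards [eventually_norm_pow_le _ (inv_pos.2 hθ) hinv (inv_pos.2 hC)] with k hk z
  have h := hk (((u : Module.End ℂ W) ^ k) z)
  rw [← Module.End.mul_apply, ← Units.val_pow_eq_pow_val, ← Units.val_pow_eq_pow_val,
    ← Units.val_mul, inv_pow, inv_mul_cancel, Units.val_one, Module.End.one_apply] at h
  rw [← Units.val_pow_eq_pow_val]
  rw [inv_pow, ← mul_inv, inv_mul_eq_div, le_div_iff₀ (by positivity)] at h
  linarith

/-- The sum of the generalized eigenspaces for the eigenvalues in a set. -/
def spectralSubspace {V : Type*} [AddCommGroup V] [Module ℂ V] (f : Module.End ℂ V) (s : Set ℂ) :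
    Submodule ℂ V :=
  ⨆ μ ∈ s, f.maxGenEigenspace μ

theorem mapsTo_spectralSubspace {V : Type*} [AddCommGroup V] [Module ℂ V] (f : Module.End ℂ V) (s : Set ℂ) {z : V}
    (hz : z ∈ spectralSubspace f s) : f z ∈ spectralSubspace f s := by
  have : spectralSubspace f s ≤ (spectralSubspace f s).comap f := by
    refine iSup₂_le fun μ hμ z hz => ?_
    exact le_biSup f.maxGenEigenspace hμ
      (Module.End.mapsTo_maxGenEigenspace_of_comm (Commute.refl f) μ hz)
  exact this hz

variable {V : Type*} [NormedAddCommGroup V] [NormedSpace ℂ V] [FiniteDimensional ℂ V]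

theorem isCompl_spectralSubspace (f : Module.End ℂ V) (s : Set ℂ) :
    IsCompl (spectralSubspace f s) (spectralSubspace f sᶜ) := by
  constructor
  · exact f.independent_maxGenEigenspace.disjoint_biSup_biSup disjoint_compl_right
  · rw [codisjoint_iff, eq_top_iff, ← Module.End.iSup_maxGenEigenspace_eq_top f]
    refine iSup_le fun μ => ?_
    by_cases h : μ ∈ s
    · exact le_sup_of_le_left (le_biSup f.maxGenEigenspace h)
    · exact le_sup_of_le_right (le_biSup f.maxGenEigenspace (i := μ) h)

theorem mem_of_hasEigenvalue_restrict (f : Module.End ℂ V) (s : Set ℂ) {μ : ℂ}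
    (h : Module.End.HasEigenvalue
      (f.restrict (fun _ => mapsTo_spectralSubspace f s)) μ) : μ ∈ s := by
  by_contra hμ
  obtain ⟨z, hz⟩ := h.exists_hasEigenvector
  have e : f (z : V) = μ • (z : V) := congrArg Subtype.val hz.apply_eq_smul
  have h1 : (z : V) ∈ spectralSubspace f sᶜ :=
    le_biSup f.maxGenEigenspace (i := μ) hμ
      (Module.End.eigenspace_le_maxGenEigenspace (Module.End.mem_eigenspace_iff.2 e))
  have := Submodule.disjoint_def.1 (isCompl_spectralSubspace f s).disjoint z z.2 h1
  exact hz.2 (Subtype.ext this)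

/-- An endomorphism with an eigenvalue outside the closed unit disc has an invariant splitting on
which a power of it is dominated. -/
theorem exists_dominated_splitting (f : Module.End ℂ V) {μ₀ : ℂ} (h₀ : f.HasEigenvalue μ₀)
    (hμ₀ : 1 < ‖μ₀‖) :
    ∃ (P : V →ₗ[ℂ] V) (K : ℕ) (ϑ : ℝ), P ≠ 0 ∧ 1 ≤ ϑ ∧ (∀ z, P (f z) = f (P z)) ∧
      (∀ z, 4 * ϑ * ‖P z‖ ≤ ‖(f ^ K) (P z)‖) ∧
      ∀ z, ‖(f ^ K) (z - P z)‖ ≤ 1 / 4 * ϑ * ‖z - P z‖ := by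
  have hfin : {μ | f.HasEigenvalue μ ∧ 1 < ‖μ‖}.Finite :=
    f.finite_hasEigenvalue.subset fun μ h => h.1
  obtain ⟨μ₁, ⟨-, hμ₁⟩, hmin⟩ := Set.exists_min_image _ (fun μ : ℂ => ‖μ‖) hfin ⟨μ₀, h₀, hμ₀⟩
  -- As `μ₁` has least modulus among the eigenvalues outside the disc, none has modulus `θ`.
  -- Eigenvalues on the unit circle fall into the slow part.
  set θ := (1 + ‖μ₁‖) / 2 with hθ
  have hθ1 : 1 < θ := by linarith
  have hθ2 : θ < ‖μ₁‖ := by linarith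
  let s : Set ℂ := {μ | θ < ‖μ‖}
  let u : Module.End ℂ (spectralSubspace f s) := f.restrict (fun _ => mapsTo_spectralSubspace f s)
  let t : Module.End ℂ (spectralSubspace f sᶜ) := f.restrict (fun _ => mapsTo_spectralSubspace f sᶜ)
  have hu : ∀ μ, u.HasEigenvalue μ → θ < ‖μ‖ := fun μ h => mem_of_hasEigenvalue_restrict f s h
  have ht : ∀ μ, t.HasEigenvalue μ → ‖μ‖ < θ := by
    intro μ h
    have h1 : ¬ θ < ‖μ‖ := mem_of_hasEigenvalue_restrict f sᶜ h
    have h2 : f.HasEigenvalue μ := by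
      obtain ⟨z, hz⟩ := h.exists_hasEigenvector
      have e : f (z : V) = μ • (z : V) := congrArg Subtype.val hz.apply_eq_smul
      exact Module.End.hasEigenvalue_of_hasEigenvector (x := (z : V))
        ⟨Module.End.mem_eigenspace_iff.2 e, fun h0 => hz.2 (Subtype.ext h0)⟩
    by_contra h3
    have h4 : ‖μ₁‖ ≤ ‖μ‖ := hmin μ ⟨h2, by linarith⟩
    linarith
  obtain ⟨K, hK1, hK2⟩ := ((eventually_le_norm_pow u (by linarith) hu four_pos).and
    (eventually_norm_pow_le t (by linarith) ht (C := 1 / 4) (by norm_num))).exists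
  have hc := isCompl_spectralSubspace f s
  have hmem : ∀ z, z - (spectralSubspace f s).projection _ hc z ∈ spectralSubspace f sᶜ := by
    intro z
    rw [← Submodule.projection_eq_self_sub_projection]
    exact Submodule.projection_apply_mem _ _
  refine ⟨(spectralSubspace f s).projection _ hc, K, θ ^ K, ?_, one_le_pow₀ hθ1.le, ?_, ?_, ?_⟩
  · intro h
    obtain ⟨z, hz⟩ := h₀.exists_hasEigenvector
    have hzs : z ∈ spectralSubspace f s :=
      le_biSup f.maxGenEigenspace (i := μ₀) (hθ2.trans_le (hmin μ₀ ⟨h₀, hμ₀⟩))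
        (Module.End.eigenspace_le_maxGenEigenspace hz.1)
    have := Submodule.projection_apply_of_mem_left hc hzs
    rw [h] at this
    exact hz.2 this.symm
  · intro z
    set P := (spectralSubspace f s).projection _ hc
    have e : f z = f (P z) + f (z - P z) := by rw [← map_add]; simp
    have h1 : P (f (P z)) = f (P z) := Submodule.projection_apply_of_mem_left hc
      (mapsTo_spectralSubspace f s (Submodule.projection_apply_mem _ _))
    have h2 : P (f (z - P z)) = 0 := Submodule.projection_apply_of_mem_right hc
      (mapsTo_spectralSubspace f sᶜ (hmem z))
    rw [e, map_add, h1, h2, add_zero]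
  · intro z
    have h := hK1 ⟨_, Submodule.projection_apply_mem hc z⟩
    have e := Module.End.pow_restrict (f' := f) (p := spectralSubspace f s) K
      (fun _ => mapsTo_spectralSubspace f s)
    simp only [u, e] at h
    exact h
  · intro z
    have h := hK2 ⟨_, hmem z⟩
    have e := Module.End.pow_restrict (f' := f) (p := spectralSubspace f sᶜ) K
      (fun _ => mapsTo_spectralSubspace f sᶜ)
    simp only [t, e] at h
    exact h

end Spectral

end Kyle

/-! ### Eigenvalues from the trace, and escape from a fixed point -/

open scoped ENNReal NNReal

namespace Kyle

/-- The trace is the sum of the roots of the characteristic polynomial, counted with multiplicity.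
-/
theorem exists_hasEigenvalue_of_trace {n : Type*} [Fintype n] [DecidableEq n] (A : Matrix n n ℂ)
    (h : (Fintype.card n : ℝ) < ‖A.trace‖) :
    ∃ μ, Module.End.HasEigenvalue (Matrix.toLin' A) μ ∧ 1 < ‖μ‖ := by
  by_contra! hcon
  have hroot : ∀ μ ∈ A.charpoly.roots, ‖μ‖ ≤ 1 := by
    intro μ hμ
    refine hcon μ ?_
    rw [Module.End.hasEigenvalue_iff_isRoot_charpoly, Matrix.charpoly_toLin']
    exact Polynomial.isRoot_of_mem_roots hμ
  have h1 : ‖A.charpoly.roots.sum‖ ≤ (A.charpoly.roots.map fun μ => ‖μ‖).sum :=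
    norm_multiset_sum_le _
  have h2 : (A.charpoly.roots.map fun μ => ‖μ‖).sum ≤ A.charpoly.roots.card • (1 : ℝ) := by
    rw [← Multiset.card_map (fun μ : ℂ => ‖μ‖)]
    refine Multiset.sum_le_card_nsmul _ _ fun x hx => ?_
    obtain ⟨μ, hμ, rfl⟩ := Multiset.mem_map.1 hx
    exact hroot μ hμ
  have h3 : A.charpoly.roots.card ≤ Fintype.card n :=
    (Polynomial.card_roots' _).trans A.charpoly_natDegree_eq_dim.le
  rw [Matrix.trace_eq_sum_roots_charpoly] at h
  have h4 : (A.charpoly.roots.card : ℝ) ≤ Fintype.card n := by exact_mod_cast h3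
  rw [nsmul_eq_mul, mul_one] at h2
  linarith

variable {N : ℕ}

/-- The inclusion of real vectors into complex vectors. -/
noncomputable def complexify (N : ℕ) : EuclideanSpace ℝ (Fin N) →L[ℝ] (Fin N → ℂ) :=
  LinearMap.toContinuousLinearMap
    { toFun := fun x i => (x i : ℂ)
      map_add' := fun x y => by ext i; simp
      map_smul' := fun r x => by ext i; simp }

theorem complexify_apply (x : EuclideanSpace ℝ (Fin N)) (i : Fin N) : complexify N x i = (x i : ℂ) := rfl

/-- The complexification of a real endomorphism. -/
noncomputable def complexEnd (M : EuclideanSpace ℝ (Fin N) →L[ℝ] EuclideanSpace ℝ (Fin N)) : Module.End ℂ (Fin N → ℂ) :=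
  Matrix.toLin' (Matrix.of fun i j => ((M (EuclideanSpace.single j 1) i : ℝ) : ℂ))

theorem complexEnd_complexify (M : EuclideanSpace ℝ (Fin N) →L[ℝ] EuclideanSpace ℝ (Fin N)) (x : EuclideanSpace ℝ (Fin N)) :
    complexEnd M (complexify N x) = complexify N (M x) := by
  ext i
  have hx : x = ∑ j, x j • EuclideanSpace.single j (1 : ℝ) := by
    ext k
    simp [Pi.single_apply]
  conv_rhs => rw [hx, map_sum]
  simp [complexEnd, complexify_apply, Matrix.mulVec, dotProduct, mul_comm]

theorem complexEnd_pow_complexify (M : EuclideanSpace ℝ (Fin N) →L[ℝ] EuclideanSpace ℝ (Fin N)) (K : ℕ) (x : EuclideanSpace ℝ (Fin N)) :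
    (complexEnd M ^ K) (complexify N x) = complexify N ((M ^ K) x) := by
  induction K generalizing x with
  | zero => simp
  | succ K ih =>
    rw [pow_succ, pow_succ, Module.End.mul_apply, complexEnd_complexify, ih]
    rfl

theorem norm_le_complexify : ∃ C : ℝ, 0 ≤ C ∧ ∀ x : EuclideanSpace ℝ (Fin N), ‖x‖ ≤ C * ‖complexify N x‖ := by
  have hinj : LinearMap.ker (complexify N : EuclideanSpace ℝ (Fin N) →ₗ[ℝ] (Fin N → ℂ)) = ⊥ := by
    refine LinearMap.ker_eq_bot'.2 fun x hx => ?_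
    ext i
    have := congrFun hx i
    exact Complex.ofReal_eq_zero.1 this
  obtain ⟨C, -, hC⟩ := LinearMap.exists_antilipschitzWith _ hinj
  refine ⟨C, C.2, fun x => ?_⟩
  simpa using hC.le_mul_dist x 0

theorem exists_real_ne_zero {P : (Fin N → ℂ) →ₗ[ℂ] (Fin N → ℂ)} (hP : P ≠ 0) :
    ∃ v : EuclideanSpace ℝ (Fin N), P (complexify N v) ≠ 0 := by
  by_contra! h
  apply hP
  refine LinearMap.pi_ext' fun i => LinearMap.ext_ring ?_
  have e : complexify N (EuclideanSpace.single i 1) = Pi.single i (1 : ℂ) := by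
    ext j
    rw [complexify_apply, PiLp.single_apply, Pi.single_apply]
    split_ifs <;> simp
  simpa [e] using h (EuclideanSpace.single i 1)

/-- Near a fixed point whose derivative has an eigenvalue outside the closed unit disc, the orbits
of the points of a nonempty open set do not all stay close to the fixed point. -/
theorem exists_orbit_escape {F : EuclideanSpace ℝ (Fin N) → EuclideanSpace ℝ (Fin N)} {b : EuclideanSpace ℝ (Fin N)} {M : EuclideanSpace ℝ (Fin N) →L[ℝ] EuclideanSpace ℝ (Fin N)} (hF : HasStrictFDerivAt F M b)
    (hb : F b = b) {μ : ℂ} (hμ : (complexEnd M).HasEigenvalue μ) (hμ1 : 1 < ‖μ‖) :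
    ∃ δ > 0, ∀ O : Set (EuclideanSpace ℝ (Fin N)), IsOpen O → O.Nonempty → ∃ x ∈ O, ∃ k, δ < ‖F^[k] x - b‖ := by
  obtain ⟨P, K, ϑ, hP, hϑ, hcomm, hPu, hPs⟩ := exists_dominated_splitting (complexEnd M) hμ hμ1
  set f := complexEnd M
  obtain ⟨v, hv⟩ := exists_real_ne_zero hP
  obtain ⟨C, hC0, hC⟩ := norm_le_complexify (N := N)
  set ι := complexify N
  have hcommK : ∀ z, P ((f ^ K) z) = (f ^ K) (P z) := fun z =>
    LinearMap.congr_fun ((Commute.pow_right (LinearMap.ext hcomm : P * f = f * P) K).eq) z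
  let PL := LinearMap.toContinuousLinearMap P
  have hPn : ∀ z, ‖P z‖ ≤ ‖PL‖ * ‖z‖ := PL.le_opNorm
  -- The aperture `R` makes the cone `0 ≤ Q` wide enough to contain the real vector `v` in its
  -- interior.
  set R := ‖ι v - P (ι v)‖ / ‖P (ι v)‖ + 1 with hR
  have hR1 : 1 ≤ R := by rw [hR]; linarith [show 0 ≤ ‖ι v - P (ι v)‖ / ‖P (ι v)‖ by positivity]
  let Q : (Fin N → ℂ) → ℝ := fun z => R * ‖P z‖ - ‖z - P z‖
  have hvpos : 0 < ‖P (ι v)‖ := norm_pos_iff.2 hv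
  have hQv : 0 < Q (ι v) := by
    have : R * ‖P (ι v)‖ = ‖ι v - P (ι v)‖ + ‖P (ι v)‖ := by rw [hR]; field_simp
    simp only [Q, this]; linarith
  set B := R * ‖PL‖ + (1 + ‖PL‖) with hB
  have hBpos : 0 < B := by positivity
  have hBn : ∀ z, R * ‖P z‖ + ‖z - P z‖ ≤ B * ‖z‖ := by
    intro z
    have h1 := hPn z
    have h2 := norm_sub_le z (P z)
    have h3 := mul_le_mul_of_nonneg_left h1 (by linarith : 0 ≤ R)
    rw [hB]; linarith
  -- This keeps the nonlinear error of `F^[K]`, measured by `B`, within a quarter of the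
  -- displacement, so that `Q` at least doubles in the cone.
  set η : ℝ := 1 / (4 * (B * (‖ι‖ * C) + 1)) with hη
  have hηpos : 0 < η := by positivity
  have hηB : B * (‖ι‖ * (η * C)) ≤ 1 / 4 := by
    have : 0 ≤ B * (‖ι‖ * C) := by positivity
    rw [hη, show B * (‖ι‖ * (1 / (4 * (B * (‖ι‖ * C) + 1)) * C)) =
      (B * (‖ι‖ * C)) / (4 * (B * (‖ι‖ * C) + 1)) by ring, div_le_iff₀ (by positivity)]
    linarith
  have hS : HasStrictFDerivAt F^[K] (M ^ K) b := hF.iterate hb K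
  obtain ⟨s, hs, happ⟩ := hS.approximates_deriv_on_nhds (c := ⟨η, hηpos.le⟩) (Or.inr hηpos)
  obtain ⟨δ, hδ, hball⟩ := Metric.nhds_basis_closedBall.mem_iff.1 hs
  have hstep : ∀ x ∈ s, ∀ y ∈ s, 0 ≤ Q (ι (x - y)) →
      2 * Q (ι (x - y)) ≤ Q (ι (F^[K] x - F^[K] y)) := by
    intro x hx y hy hQ
    have he := happ x hx y hy
    change ‖_‖ ≤ η * _ at he
    set z := x - y
    set e := F^[K] x - F^[K] y - (M ^ K) z with he'
    have hxy : F^[K] x - F^[K] y = (M ^ K) z + e := by rw [he']; abel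
    rw [hxy, map_add, ← complexEnd_pow_complexify]
    change 2 * Q (ι z) ≤ Q ((f ^ K) (ι z) + ι e)
    have hz := hC z
    have hie : B * ‖ι e‖ ≤ 1 / 4 * ‖ι z‖ := by
      calc B * ‖ι e‖ ≤ B * (‖ι‖ * (η * (C * ‖ι z‖))) := by
            gcongr
            refine (ι.le_opNorm e).trans ?_
            gcongr
            exact he.trans (by gcongr)
        _ = B * (‖ι‖ * (η * C)) * ‖ι z‖ := by ring
        _ ≤ 1 / 4 * ‖ι z‖ := by gcongr
    generalize ι z = w at *
    generalize ι e = g at *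
    have h1 := hPu w
    have h2 := hPs w
    have h3 := hBn g
    have h4 : ‖w‖ ≤ ‖P w‖ + ‖w - P w‖ := by
      have := norm_add_le (P w) (w - P w)
      rwa [add_sub_cancel] at this
    have h5 : ‖(f ^ K) (P w)‖ - ‖P g‖ ≤ ‖P ((f ^ K) w + g)‖ := by
      rw [map_add, hcommK]
      have := norm_sub_le ((f ^ K) (P w) + P g) (P g)
      rw [add_sub_cancel_right] at this
      linarith
    have h6 : ‖(f ^ K) w + g - P ((f ^ K) w + g)‖ ≤ ‖(f ^ K) (w - P w)‖ + ‖g - P g‖ := by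
      rw [map_add, hcommK, map_sub]
      rw [add_sub_add_comm]
      exact norm_add_le _ _
    simp only [Q] at hQ ⊢
    have ha : 0 ≤ ‖P w‖ := norm_nonneg _
    have hb' : 0 ≤ ‖w - P w‖ := norm_nonneg _
    generalize ‖P w‖ = a at *
    generalize ‖w - P w‖ = b at *
    have h7 := mul_le_mul_of_nonneg_left h5 (by linarith : 0 ≤ R)
    have h8 := mul_le_mul_of_nonneg_left h1 (by linarith : 0 ≤ R)
    have h9 : ϑ * b ≤ ϑ * (R * a) := by gcongr; linarith
    have h10 : R * a ≤ ϑ * (R * a) := le_mul_of_one_le_left (by positivity) hϑ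
    have h11 : a ≤ R * a := le_mul_of_one_le_left ha hR1
    linarith
  refine ⟨δ, hδ, fun O hO ⟨x, hx⟩ => ?_⟩
  by_contra! hcon
  have hmem : ∀ y ∈ O, ∀ k, F^[k] y ∈ s := fun y hy k =>
    hball (by rw [Metric.mem_closedBall, dist_eq_norm]; exact hcon y hy k)
  -- Two points of `O` that differ by a vector of the cone: their `Q`-separation grows like `2 ^ j`,
  -- yet both orbits stay in a bounded ball.
  obtain ⟨t, ht, htO⟩ : ∃ t : ℝ, 0 < t ∧ x + t • v ∈ O := by
    have hcont : ContinuousAt (fun t : ℝ => x + t • v) 0 := by fun_prop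
    have h := hcont.eventually (show ∀ᶠ y in 𝓝 (x + (0 : ℝ) • v), y ∈ O by
      simpa using hO.mem_nhds hx)
    obtain ⟨t, h1, h2⟩ := ((h.filter_mono nhdsWithin_le_nhds).and
      (self_mem_nhdsWithin (a := (0 : ℝ)) (s := Set.Ioi 0))).exists
    exact ⟨t, h2, h1⟩
  set y := x + t • v with hy
  have hit : ∀ j z, (F^[K])^[j] z = F^[K * j] z := fun j z => by rw [Function.iterate_mul]
  have hQpos : 0 < Q (ι (y - x)) := by
    have : y - x = t • v := by rw [hy]; abel
    have hq : Q (ι (t • v)) = t * Q (ι v) := by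
      have e1 : ι (t • v) = (t : ℂ) • ι v := by
        rw [map_smul]; exact (Complex.coe_smul t _).symm
      simp only [Q, e1, map_smul, ← smul_sub, norm_smul, Complex.norm_real, Real.norm_eq_abs,
        abs_of_pos ht]
      ring
    rw [this, hq]; positivity
  have hgrow : ∀ j : ℕ, 2 ^ j * Q (ι (y - x)) ≤ Q (ι ((F^[K])^[j] y - (F^[K])^[j] x)) := by
    intro j
    induction j with
    | zero => simp
    | succ j ih =>
      have h1 : 0 ≤ Q (ι ((F^[K])^[j] y - (F^[K])^[j] x)) := le_trans (by positivity) ih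
      have h2 := hstep _ (by rw [hit]; exact hmem y htO _) _ (by rw [hit]; exact hmem x hx _) h1
      rw [Function.iterate_succ_apply', Function.iterate_succ_apply', pow_succ]
      linarith
  have hbound : ∀ j : ℕ, 2 ^ j * Q (ι (y - x)) ≤ B * (‖ι‖ * (δ + δ)) := by
    intro j
    refine (hgrow j).trans ?_
    set z := (F^[K])^[j] y - (F^[K])^[j] x with hz
    have h1 := hBn (ι z)
    have h2 : Q (ι z) ≤ R * ‖P (ι z)‖ + ‖ι z - P (ι z)‖ := by
      simp only [Q]
      linarith [norm_nonneg (ι z - P (ι z))]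
    have h3 : ‖z‖ ≤ δ + δ := by
      have e : z = (F^[K * j] y - b) - (F^[K * j] x - b) := by rw [hz, hit, hit]; abel
      rw [e]
      exact (norm_sub_le _ _).trans (add_le_add (hcon y htO _) (hcon x hx _))
    refine h2.trans (h1.trans ?_)
    gcongr
    exact (ι.le_opNorm z).trans (by gcongr)
  obtain ⟨j, hj⟩ := pow_unbounded_of_one_lt (B * (‖ι‖ * (δ + δ)) / Q (ι (y - x)))
    (one_lt_two : (1 : ℝ) < 2)
  rw [div_lt_iff₀ hQpos] at hj
  linarith [hbound j]

end Kyle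

/-! ### Instability of the equilibrium -/

namespace Kyle

/-- The entries `0` and about `-0.98` exceed `-1`; the surplus of the third, about `-2.076`,
outweighs them. -/
theorem sum_diagDeriv_lt (m : ℕ) :
    ∑ k ∈ Finset.range (m + 3), diagDeriv k < -((m + 3 : ℕ) : ℝ) := by
  induction m with
  | zero =>
    rw [Finset.sum_range_succ, Finset.sum_range_succ, Finset.sum_range_one, diagDeriv_zero]
    have h1 := diagDeriv_one_le
    have h2 := diagDeriv_two_mem.2
    norm_num
    linarith
  | succ m ih =>
    rw [show m + 1 + 3 = (m + 3) + 1 by ring, Finset.sum_range_succ]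
    have := diagDeriv_le (m + 1)
    push_cast at ih ⊢
    linarith

variable {N : ℕ} {Δ σ V : ℝ} {c : Coeffs N}

theorem Coeffs.IsEquilibrium.fderiv_single (h : c.IsEquilibrium Δ σ V) (hΔ : 0 < Δ) (hσ : 0 < σ)
    (hV : 0 < V) (i : Fin N) :
    fderiv ℝ (iter Δ σ V) c.beta (EuclideanSpace.single i 1) i = diagDeriv (N - 1 - i) := by
  obtain ⟨S', L', A', H⟩ :=
    exists_isLinearization hΔ hσ hV h.mem_dom (EuclideanSpace.single i 1)
  exact H.apply_eq_diagDeriv h hΔ hσ hV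

theorem Coeffs.IsEquilibrium.exists_hasEigenvalue (h : c.IsEquilibrium Δ σ V) (hN : 3 ≤ N)
    (hΔ : 0 < Δ) (hσ : 0 < σ) (hV : 0 < V) :
    ∃ μ, (complexEnd (fderiv ℝ (iter Δ σ V) c.beta)).HasEigenvalue μ ∧ 1 < ‖μ‖ := by
  refine exists_hasEigenvalue_of_trace _ ?_
  have htr : Matrix.trace (Matrix.of fun i j : Fin N =>
      ((fderiv ℝ (iter Δ σ V) c.beta (EuclideanSpace.single j 1) i : ℝ) : ℂ)) =
      ((∑ k ∈ Finset.range N, diagDeriv k : ℝ) : ℂ) := by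
    rw [← Finset.sum_range_reflect, Finset.sum_range, Complex.ofReal_sum]
    exact Finset.sum_congr rfl fun i _ => congrArg Complex.ofReal (h.fderiv_single hΔ hσ hV i)
  rw [htr, Complex.norm_real, Real.norm_eq_abs, Fintype.card_fin]
  obtain ⟨m, rfl⟩ := Nat.exists_eq_add_of_le' hN
  exact lt_abs.2 (Or.inr (by linarith [sum_diagDeriv_lt m]))

theorem T_coe_of_mem {β : EuclideanSpace ℝ (Fin N)} (hβ : β ∈ dom Δ σ V) :
    T Δ σ V (OnePoint.some β) = OnePoint.some (iter Δ σ V β) :=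
  if_pos hβ

theorem T_coe_of_notMem {β : EuclideanSpace ℝ (Fin N)} (hβ : β ∉ dom Δ σ V) :
    T Δ σ V (OnePoint.some β) = OnePoint.infty :=
  if_neg hβ

theorem T_iterate_infty (m : ℕ) :
    (T Δ σ V)^[m] (OnePoint.infty : OnePoint (EuclideanSpace ℝ (Fin N))) = OnePoint.infty :=
  Function.iterate_fixed rfl m

theorem T_iterate_coe {x : EuclideanSpace ℝ (Fin N)}
    (hx : ∀ m, (T Δ σ V)^[m] (OnePoint.some x) ≠ OnePoint.infty) (m : ℕ) :
    (T Δ σ V)^[m] (OnePoint.some x) = OnePoint.some ((iter Δ σ V)^[m] x) ∧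
      (iter Δ σ V)^[m] x ∈ dom Δ σ V := by
  have hmem : ∀ m, (T Δ σ V)^[m] (OnePoint.some x) = OnePoint.some ((iter Δ σ V)^[m] x) →
      (iter Δ σ V)^[m] x ∈ dom Δ σ V := by
    intro m hm
    by_contra hcon
    apply hx (m + 1)
    rw [Function.iterate_succ_apply', hm, T_coe_of_notMem hcon]
  induction m with
  | zero => exact ⟨rfl, hmem 0 rfl⟩
  | succ m ih =>
    have e : (T Δ σ V)^[m + 1] (OnePoint.some x) = OnePoint.some ((iter Δ σ V)^[m + 1] x) := by
      rw [Function.iterate_succ_apply', ih.1, T_coe_of_mem ih.2, Function.iterate_succ_apply']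
    exact ⟨e, hmem _ e⟩

theorem T_iterate_ne_infty {x b : EuclideanSpace ℝ (Fin N)}
    (h : Tendsto (fun m : ℕ => (T Δ σ V)^[m] (OnePoint.some x)) atTop (𝓝 (OnePoint.some b)))
    (m : ℕ) : (T Δ σ V)^[m] (OnePoint.some x) ≠ OnePoint.infty := by
  intro hm
  have hev : (fun k : ℕ => (T Δ σ V)^[k] (OnePoint.some x)) =ᶠ[atTop] fun _ => OnePoint.infty := by
    filter_upwards [eventually_ge_atTop m] with k hk
    obtain ⟨j, rfl⟩ := Nat.exists_eq_add_of_le' hk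
    rw [Function.iterate_add_apply, hm, T_iterate_infty]
  exact OnePoint.coe_ne_infty b (tendsto_nhds_unique h (tendsto_const_nhds.congr' hev.symm))

theorem iterate_image_interior_nonempty (hΔ : 0 < Δ) (hσ : 0 < σ) (hV : 0 < V)
    {O : Set (EuclideanSpace ℝ (Fin N))} (hO : IsOpen O) (hne : O.Nonempty)
    (hd : ∀ x ∈ O, ∀ k, (iter Δ σ V)^[k] x ∈ dom Δ σ V) (m : ℕ) :
    (interior ((iter Δ σ V)^[m] '' O)).Nonempty := by
  induction m with
  | zero => simpa [hO.interior_eq] using hne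
  | succ m ih =>
    refine (iter_image_interior_nonempty hΔ hσ hV isOpen_interior ih ?_).mono
      (interior_mono ?_)
    · refine interior_subset.trans ?_
      rintro _ ⟨x, hx, rfl⟩
      exact hd x hx m
    · rw [Function.iterate_succ', Set.image_comp]
      exact Set.image_mono interior_subset

theorem Coeffs.IsEquilibrium.not_isLocallyStable (h : c.IsEquilibrium Δ σ V) (hN : 3 ≤ N)
    (hΔ : 0 < Δ) (hσ : 0 < σ) (hV : 0 < V) : ¬ IsLocallyStable Δ σ V c.beta := by
  rintro ⟨ε, hε, hstab⟩
  set F : EuclideanSpace ℝ (Fin N) → EuclideanSpace ℝ (Fin N) := iter Δ σ V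
  set b := c.beta
  have hFb : F b = b := h.bestResponse_eq
  obtain ⟨μ, hμ, hμ1⟩ := h.exists_hasEigenvalue hN hΔ hσ hV
  obtain ⟨δ, hδ, hesc⟩ := exists_orbit_escape
    ((contDiffAt_iter hΔ hσ hV h.mem_dom).hasStrictFDerivAt one_ne_zero) hFb hμ hμ1
  have hdom : IsOpen (dom Δ σ V : Set (EuclideanSpace ℝ (Fin N))) := isOpen_dom hΔ hσ hV
  obtain ⟨r, hr, hball⟩ := Metric.isOpen_iff.1 hdom b h.mem_dom
  let U := Metric.ball b (min r ε)
  have hUo : IsOpen U := Metric.isOpen_ball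
  have hbU : b ∈ U := Metric.mem_ball_self (lt_min hr hε)
  have hlim : ∀ x ∈ U,
      Tendsto (fun m : ℕ => (T Δ σ V)^[m] (OnePoint.some x)) atTop (𝓝 (OnePoint.some b)) := by
    intro x hx
    have hx' : ‖x - b‖ < min r ε := by rwa [← dist_eq_norm]
    rcases eq_or_ne x b with rfl | hne
    · have hfix : T Δ σ V (OnePoint.some b) = OnePoint.some b := by
        rw [T_coe_of_mem h.mem_dom]; exact congrArg _ hFb
      simpa only [Function.iterate_fixed hfix] using tendsto_const_nhds
    · exact hstab x (hball (Metric.ball_subset_ball (min_le_left _ _) hx))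
        (norm_pos_iff.2 (sub_ne_zero.2 hne)) (hx'.trans_le (min_le_right _ _))
  -- Since `∞` is absorbing, a convergent orbit never leaves the domain, and `T` can be replaced by
  -- `iter`.
  have horb : ∀ x ∈ U, ∀ k, F^[k] x ∈ dom Δ σ V := fun x hx k =>
    (T_iterate_coe (T_iterate_ne_infty (hlim x hx)) k).2
  have hconv : ∀ x ∈ U, Tendsto (fun k => F^[k] x) atTop (𝓝 b) := by
    intro x hx
    have := hlim x hx
    simp only [(T_iterate_coe (T_iterate_ne_infty (hlim x hx)) _).1] at this
    exact OnePoint.isOpenEmbedding_coe.isInducing.tendsto_nhds_iff.2 this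
  have hcont : ∀ k, ContinuousOn F^[k] U := by
    intro k
    induction k with
    | zero => exact continuousOn_id
    | succ k ih =>
      rw [Function.iterate_succ']
      exact ContinuousOn.comp (t := dom Δ σ V)
        (fun y hy => (contDiffAt_iter hΔ hσ hV hy).continuousAt.continuousWithinAt) ih
        fun x hx => horb x hx k
  have : BaireSpace U := hUo.baireSpace
  have : Nonempty U := ⟨⟨b, hbU⟩⟩
  -- Points whose orbits stay within `δ` of `b` from time `m` on. Convergence makes these closed
  -- sets cover `U`, so one of them has interior.
  let A : ℕ → Set U := fun m => ⋂ k, {x | ‖F^[m + k] x - b‖ ≤ δ}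
  have hAc : ∀ m, IsClosed (A m) := fun m => isClosed_iInter fun k =>
    isClosed_le (((continuousOn_iff_continuous_domRestrict.1 (hcont (m + k))).sub
      continuous_const).norm) continuous_const
  have hAu : ⋃ m, A m = Set.univ := by
    refine Set.eq_univ_of_forall fun x => ?_
    have hev := (hconv x x.2).eventually (Metric.closedBall_mem_nhds b hδ)
    obtain ⟨m, hm⟩ := eventually_atTop.1 hev
    refine Set.mem_iUnion.2 ⟨m, Set.mem_iInter.2 fun k => ?_⟩
    have := hm (m + k) (Nat.le_add_right m k)
    rwa [dist_eq_norm] at this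
  obtain ⟨m, hm⟩ := nonempty_interior_of_iUnion_of_closed hAc hAu
  let O : Set (EuclideanSpace ℝ (Fin N)) := Subtype.val '' interior (A m)
  have hO : IsOpen O := hUo.isOpenMap_subtype_val _ isOpen_interior
  have hOU : ∀ x ∈ O, x ∈ U ∧ ∀ k, ‖F^[m + k] x - b‖ ≤ δ := by
    rintro _ ⟨x, hx, rfl⟩
    exact ⟨x.2, fun k => Set.mem_iInter.1 (interior_subset hx) k⟩
  -- The escape lemma controls orbits from time `0`, so it is applied to the interior of the image
  -- of `O` under `m` steps.
  obtain ⟨y, hy, k, hk⟩ := hesc _ isOpen_interior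
    (iterate_image_interior_nonempty hΔ hσ hV hO (hm.image _)
      (fun x hx => horb x (hOU x hx).1) m)
  obtain ⟨x, hx, rfl⟩ := interior_subset hy
  have := (hOU x hx).2 k
  rw [add_comm, Function.iterate_add_apply] at this
  exact this.not_gt hk

/-- Updating one coordinate moves along a coordinate line, so the chain rule gives a diagonal entry
of the Jacobian. -/
theorem Coeffs.IsEquilibrium.hasFiniteDerivAt_scalarT (h : c.IsEquilibrium Δ σ V) (hΔ : 0 < Δ)
    (hσ : 0 < σ) (hV : 0 < V) (i : Fin N) :
    HasFiniteDerivAt (scalarT Δ σ V c.beta i) (diagDeriv (N - 1 - i)) (c.beta i) := by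
  let γ : ℝ → EuclideanSpace ℝ (Fin N) := fun y =>
    c.beta + (y - c.beta i) • EuclideanSpace.single i 1
  have hγe : ∀ y, WithLp.toLp 2 (Function.update (⇑c.beta) i y) = γ y := by
    intro y
    ext j
    rcases eq_or_ne j i with rfl | hj
    · simp [γ]
    · simp [γ, hj]
  have hγ0 : γ (c.beta i) = c.beta := by simp [γ]
  have hγd : HasDerivAt γ (EuclideanSpace.single i 1) (c.beta i) := by
    have := (((hasDerivAt_id (c.beta i)).sub_const (c.beta i)).smul_const
      (EuclideanSpace.single i (1 : ℝ))).const_add c.beta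
    rwa [one_smul] at this
  refine ⟨fun y => iter Δ σ V (γ y) i, ?_, ?_⟩
  · have hev := hγd.continuousAt.eventually
      (show ∀ᶠ β in 𝓝 (γ (c.beta i)), β ∈ dom Δ σ V by
        rw [hγ0]; exact (isOpen_dom hΔ hσ hV).mem_nhds h.mem_dom)
    filter_upwards [hev] with y hy
    rw [scalarT, hγe, T_coe_of_mem hy]
    rfl
  · have hF : HasFDerivAt (iter Δ σ V) (fderiv ℝ (iter Δ σ V) c.beta) (γ (c.beta i)) := by
      rw [hγ0]
      exact ((contDiffAt_iter hΔ hσ hV h.mem_dom).differentiableAt one_ne_zero).hasFDerivAt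
    rw [← h.fderiv_single hΔ hσ hV i]
    exact (EuclideanSpace.proj i : EuclideanSpace ℝ (Fin N) →L[ℝ] ℝ).hasFDerivAt.comp_hasDerivAt
      (c.beta i) (hF.comp_hasDerivAt (c.beta i) hγd)

theorem tendsto_abs_of_affine_recursion {b d : ℝ} (hd : 1 < |d|) {x : ℕ → ℝ} (h0 : x 0 ≠ b)
    (hx : ∀ m, x (m + 1) = b + d * (x m - b)) : Tendsto (fun m => |x m|) atTop atTop := by
  have hpow : ∀ m, x m - b = d ^ m * (x 0 - b) := by
    intro m
    induction m with
    | zero => simp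
    | succ m ih => rw [hx, add_sub_cancel_left, ih]; ring
  have hlim : Tendsto (fun m : ℕ => |d| ^ m * |x 0 - b| - |b|) atTop atTop :=
    tendsto_atTop_add_const_right _ _
      ((tendsto_pow_atTop_atTop_of_one_lt hd).atTop_mul_const (abs_pos.2 (sub_ne_zero.2 h0)))
  refine tendsto_atTop_mono (fun m => ?_) hlim
  rw [← abs_pow, ← abs_mul, ← hpow]
  linarith [abs_sub (x m) b]

end Kyle

theorem theorem5p1 :
    ∃ d : ℝ, -2.07612 < d ∧ d ≤ -2.07611 ∧
      ∀ (N : ℕ) (hN : 3 ≤ N) (Δ σ V : ℝ), 0 < Δ → 0 < σ → 0 < V →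
        (∃! c : Kyle.Coeffs N, c.IsEquilibrium Δ σ V) ∧
        ∀ c : Kyle.Coeffs N, c.IsEquilibrium Δ σ V →
          Kyle.HasFiniteDerivAt (Kyle.scalarT Δ σ V c.beta ⟨N - 3, by omega⟩) d
            (c.beta ⟨N - 3, by omega⟩) ∧
          (∀ x : ℕ → ℝ, x 0 ≠ c.beta ⟨N - 3, by omega⟩ →
            (∀ m : ℕ, x (m + 1) = c.beta ⟨N - 3, by omega⟩ +
              d * (x m - c.beta ⟨N - 3, by omega⟩)) →
            Tendsto (fun m : ℕ => |x m|) atTop atTop) ∧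
          ¬ Kyle.IsLocallyStable Δ σ V c.beta := by
  obtain ⟨h1, h2⟩ := Kyle.diagDeriv_two_mem
  refine ⟨Kyle.diagDeriv 2, h1, h2, fun N hN Δ σ V hΔ hσ hV =>
    ⟨Kyle.existsUnique_isEquilibrium hΔ hσ hV, fun c hc => ⟨?_, fun x h0 hx => ?_,
      hc.not_isLocallyStable hN hΔ hσ hV⟩⟩⟩
  · have h := hc.hasFiniteDerivAt_scalarT hΔ hσ hV ⟨N - 3, by omega⟩
    -- Index `N - 3` is trading time `N - 2`, which leaves two trades.
    rwa [show N - 1 - (N - 3) = 2 by omega] at h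
  · exact Kyle.tendsto_abs_of_affine_recursion (lt_abs.2 (Or.inr (by linarith))) h0 hx
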